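/- Let $(M,g,J)$ be a Kähler manifold of real dimension $m$ (that is, $g$ is a smooth Riemannian metric, $J$ is a smooth almost complex structure with $g(JX,JY)=g(X,Y)$, and $\nabla J=0$ for the Levi-Civita connection $\nabla$ of $g$). Let $\gamma$ be a smooth real function on $M$ such that $J\big(e^{\frac{m-6}{2}\gamma}\operatorname{grad}\gamma\big)$ is a Killing vector field of $(M,g)$. If $$\Delta\gamma+\tfrac{m-2}{2}\,|\operatorname{grad}\gamma|^2=0,$$ where $\Delta f=\operatorname{trace}\nabla df$ and the gradient, the norm and the Laplacian are those of $g$, then any holomorphic map $\varphi$ (a smooth map with $d\varphi\circ J=J^N\circ d\varphi$) from $(M,e^{2\gamma}g,J)$ into any almost Hermitian manifold $(N,h,J^N)$ which is $(1,2)$-symplectic (i.e. the $(1,2)$-part of $d\Omega$ vanishes, $\Omega(X,Y)=h(X,J^NY)$) is biharmonic from $(M,e^{2\gamma}g)$ to $(N,h)$; that is, its bitension field $$\tau_2(\varphi)=\operatorname{trace}(\nabla^\varphi)^2\tau(\varphi)+\sum_{i=1}^m R^N\big(\tau(\varphi),d\varphi(e_i)\big)d\varphi(e_i)$$ vanishes,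 where $\{e_i\}$ is a local orthonormal frame for $e^{2\gamma}g$, $\tau(\varphi)=\operatorname{trace}\nabla d\varphi$ is the tension field (traces with respect to $e^{2\gamma}g$), $\nabla^\varphi$ is the pull-back connection on $\varphi^{-1}TN$, and $R^N(X,Y)Z=\nabla_X\nabla_YZ-\nabla_Y\nabla_XZ-\nabla_{[X,Y]}Z$. -/

import Mathlib

open scoped Manifold ContDiff

noncomputable section

namespace BiharmonicGeometry

/-! ## Riemannian geometry in an open set of a vector space

A metric on (an open subset of) `E` is a field `G` of bilinear forms. Constant vectors
`u v w : E` stand for the corresponding coordinate vector fields. -/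

section Local

variable {E F : Type*} [NormedAddCommGroup E] [NormedSpace ℝ E] [FiniteDimensional ℝ E]
  [NormedAddCommGroup F] [NormedSpace ℝ F]

/-- The Levi-Civita connection in coordinates, `Γ(u, v) = ∇_u v` for constant `u`, `v`:
the vector with `G(Γ(u,v), z) = ½ (∂_u G(v,z) + ∂_v G(u,z) - ∂_z G(u,v))` for all `z`. -/
def christoffel (G : E → E →L[ℝ] E →L[ℝ] ℝ) (x u v : E) : E :=
  (G x).inverse ((1 / 2 : ℝ) •
    (fderiv ℝ G x u v + fderiv ℝ G x v u - ((fderiv ℝ G x).flip u).flip v))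

/-- The curvature `R(u,v)w = ∇_u ∇_v w - ∇_v ∇_u w - ∇_[u,v] w` in coordinates. -/
def curvature (G : E → E →L[ℝ] E →L[ℝ] ℝ) (x u v w : E) : E :=
  fderiv ℝ (fun y => christoffel G y v w) x u - fderiv ℝ (fun y => christoffel G y u w) x v
    + christoffel G x u (christoffel G x v w) - christoffel G x v (christoffel G x u w)

/-- The trace with respect to `G` of a bilinear map `b`: the sum of `G^{ij} b(e_i, e_j)` over a
basis `e`, written as the sum of `b(e_i, (e^i)♯)` with `e^i` the dual basis. -/
def traceOf (G : E → E →L[ℝ] E →L[ℝ] ℝ) (x : E) (b : E → E → F) : F :=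
  ∑ i, b (Module.finBasis ℝ E i)
    ((G x).inverse (LinearMap.toContinuousLinearMap ((Module.finBasis ℝ E).coord i)))

/-- The Hessian `∇df` of a function. -/
def hessian (G : E → E →L[ℝ] E →L[ℝ] ℝ) (f : E → ℝ) (x u v : E) : ℝ :=
  fderiv ℝ (fun y => fderiv ℝ f y v) x u - fderiv ℝ f x (christoffel G x u v)

/-- The Lie derivative `(L_X G)(u, v)`. -/
def lieDerivMetric (G : E → E →L[ℝ] E →L[ℝ] ℝ) (X : E → E) (x u v : E) : ℝ :=
  fderiv ℝ G x (X x) u v + G x (fderiv ℝ X x u) v + G x u (fderiv ℝ X x v)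

/-- The covariant derivative `(∇_u J) v` of an endomorphism field. -/
def covDerivEnd (G : E → E →L[ℝ] E →L[ℝ] ℝ) (J : E → E →L[ℝ] E) (x u v : E) : E :=
  fderiv ℝ J x u v + christoffel G x u (J x v) - J x (christoffel G x u v)

/-- The exterior derivative `dΩ(u, v, w)` of the fundamental form `Ω(u, v) = G(u, J v)`. -/
def dFundamentalForm (G : E → E →L[ℝ] E →L[ℝ] ℝ) (J : E → E →L[ℝ] E) (x u v w : E) : ℝ :=
  fderiv ℝ (fun y => G y v (J y w)) x u + fderiv ℝ (fun y => G y w (J y u)) x v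
    + fderiv ℝ (fun y => G y u (J y v)) x w

/-- The complex trilinear extension of a real trilinear form; the pair `a = (a₁, a₂)` stands for
the complexified vector `a₁ + i a₂`. -/
def complexExtension (α : E → E → E → ℝ) (a b c : E × E) : ℂ :=
  ⟨α a.1 b.1 c.1 - α a.1 b.2 c.2 - α a.2 b.1 c.2 - α a.2 b.2 c.1,
   α a.2 b.1 c.1 + α a.1 b.2 c.1 + α a.1 b.1 c.2 - α a.2 b.2 c.2⟩

end Local

section LocalMaps

variable {E F : Type*} [NormedAddCommGroup E] [NormedSpace ℝ E] [FiniteDimensional ℝ E]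
  [NormedAddCommGroup F] [NormedSpace ℝ F] [FiniteDimensional ℝ F]

/-- The pull-back connection: `∇^φ_u V` for a section `V` of `φ⁻¹TN`. -/
def covAlong (H : F → F →L[ℝ] F →L[ℝ] ℝ) (φ V : E → F) (x u : E) : F :=
  fderiv ℝ V x u + christoffel H (φ x) (fderiv ℝ φ x u) (V x)

/-- The second covariant derivative `∇^φ_u ∇^φ_v V - ∇^φ_{∇_u v} V`. -/
def secondCovAlong (G : E → E →L[ℝ] E →L[ℝ] ℝ) (H : F → F →L[ℝ] F →L[ℝ] ℝ)
    (φ V : E → F) (x u v : E) : F :=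
  covAlong H φ (fun y => covAlong H φ V y v) x u - covAlong H φ V x (christoffel G x u v)

/-- The second fundamental form `∇dφ(u, v) = ∇^φ_u (dφ v) - dφ(∇_u v)`. -/
def secondFundamentalForm (G : E → E →L[ℝ] E →L[ℝ] ℝ) (H : F → F →L[ℝ] F →L[ℝ] ℝ)
    (φ : E → F) (x u v : E) : F :=
  covAlong H φ (fun y => fderiv ℝ φ y v) x u - fderiv ℝ φ x (christoffel G x u v)

/-- The tension field `τ(φ) = trace ∇dφ`. -/
def tension (G : E → E →L[ℝ] E →L[ℝ] ℝ) (H : F → F →L[ℝ] F →L[ℝ] ℝ) (φ : E → F) (x : E) : F :=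
  traceOf G x (secondFundamentalForm G H φ x)

/-- The bitension field
`τ₂(φ) = trace (∇^φ)² τ(φ) + ∑ R(τ(φ), dφ e_i) dφ e_i`. -/
def bitension (G : E → E →L[ℝ] E →L[ℝ] ℝ) (H : F → F →L[ℝ] F →L[ℝ] ℝ) (φ : E → F) (x : E) : F :=
  traceOf G x (secondCovAlong G H φ (tension G H φ) x)
    + traceOf G x (fun u v =>
        curvature H (φ x) (tension G H φ x) (fderiv ℝ φ x u) (fderiv ℝ φ x v))

end LocalMaps

/-! ## Manifolds -/

section Global

variable {E : Type*} [NormedAddCommGroup E] [NormedSpace ℝ E] [FiniteDimensional ℝ E]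
  {M : Type*} [TopologicalSpace M] [ChartedSpace E M] [IsManifold 𝓘(ℝ, E) ∞ M]

variable (E M) in
/-- Smooth Riemannian metrics on the manifold `M`. -/
abbrev Metric : Type _ :=
  Bundle.ContMDiffRiemannianMetric 𝓘(ℝ, E) ∞ E (fun p : M => TangentSpace 𝓘(ℝ, E) p)

variable (E M) in
/-- Smooth almost complex structures on the manifold `M`. -/
structure AlmostComplexStructure where
  /-- The endomorphism of each tangent space. -/
  toFun (p : M) : TangentSpace 𝓘(ℝ, E) p →L[ℝ] TangentSpace 𝓘(ℝ, E) p
  sq_eq_neg (p : M) (v : TangentSpace 𝓘(ℝ, E) p) : toFun p (toFun p v) = -v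
  contMDiff : ContMDiff 𝓘(ℝ, E) (𝓘(ℝ, E).prod 𝓘(ℝ, E →L[ℝ] E)) ∞
    (fun p => Bundle.TotalSpace.mk' (E →L[ℝ] E)
      (E := fun p : M => TangentSpace 𝓘(ℝ, E) p →L[ℝ] TangentSpace 𝓘(ℝ, E) p) p (toFun p))

/-- The coordinate frame at the point with coordinates `x` in the chart around `p`. -/
def chartFrame (p : M) (x : E) :
    E →L[ℝ] TangentSpace 𝓘(ℝ, E) ((extChartAt 𝓘(ℝ, E) p).symm x) :=
  mfderiv 𝓘(ℝ, E) 𝓘(ℝ, E) (extChartAt 𝓘(ℝ, E) p).symm x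

/-- The components of tangent vectors at `q` in the chart around `p`. -/
def chartCoframe (p q : M) : TangentSpace 𝓘(ℝ, E) q →L[ℝ] E :=
  mfderiv 𝓘(ℝ, E) 𝓘(ℝ, E) (extChartAt 𝓘(ℝ, E) p) q

/-- A metric in the coordinates of the chart around `p`. -/
def metricInChart (g : Metric E M) (p : M) (x : E) : E →L[ℝ] E →L[ℝ] ℝ :=
  ContinuousLinearMap.bilinearComp (E := E) (F := E)
    (g.inner ((extChartAt 𝓘(ℝ, E) p).symm x)) (chartFrame p x) (chartFrame p x)

/-- A vector field in the coordinates of the chart around `p`. -/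
def fieldInChart (X : ∀ q : M, TangentSpace 𝓘(ℝ, E) q) (p : M) (x : E) : E :=
  chartCoframe p ((extChartAt 𝓘(ℝ, E) p).symm x) (X ((extChartAt 𝓘(ℝ, E) p).symm x))

/-- An almost complex structure in the coordinates of the chart around `p`. -/
def complexInChart (J : AlmostComplexStructure E M) (p : M) (x : E) : E →L[ℝ] E :=
  (chartCoframe p ((extChartAt 𝓘(ℝ, E) p).symm x)).comp
    ((J.toFun ((extChartAt 𝓘(ℝ, E) p).symm x)).comp (chartFrame p x))

/-- The gradient of a function. -/
def grad (g : Metric E M) (f : M → ℝ) (p : M) : TangentSpace 𝓘(ℝ, E) p :=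
  (g.inner p).inverse (mvfderiv 𝓘(ℝ, E) f p)

/-- The Laplacian `Δf = trace ∇df` of a function. -/
def laplacian (g : Metric E M) (f : M → ℝ) (p : M) : ℝ :=
  traceOf (metricInChart g p) (extChartAt 𝓘(ℝ, E) p p)
    (hessian (metricInChart g p) (f ∘ (extChartAt 𝓘(ℝ, E) p).symm) (extChartAt 𝓘(ℝ, E) p p))

/-- Killing vector fields: smooth vector fields with `L_X g = 0`. -/
def IsKilling (g : Metric E M) (X : ∀ q : M, TangentSpace 𝓘(ℝ, E) q) : Prop :=
  ContMDiff 𝓘(ℝ, E) 𝓘(ℝ, E).tangent ∞ (fun q => (⟨q, X q⟩ : TangentBundle 𝓘(ℝ, E) M)) ∧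
  ∀ p : M, ∀ x ∈ (extChartAt 𝓘(ℝ, E) p).target, ∀ u v : E,
    lieDerivMetric (metricInChart g p) (fieldInChart X p) x u v = 0

/-- `(M, g, J)` is almost Hermitian. -/
def IsAlmostHermitian (g : Metric E M) (J : AlmostComplexStructure E M) : Prop :=
  ∀ (p : M) (u v : TangentSpace 𝓘(ℝ, E) p), g.inner p (J.toFun p u) (J.toFun p v) = g.inner p u v

/-- `(M, g, J)` is Kähler: almost Hermitian with `∇J = 0`. -/
def IsKahler (g : Metric E M) (J : AlmostComplexStructure E M) : Prop :=
  IsAlmostHermitian g J ∧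
  ∀ p : M, ∀ x ∈ (extChartAt 𝓘(ℝ, E) p).target, ∀ u v : E,
    covDerivEnd (metricInChart g p) (complexInChart J p) x u v = 0

/-- `(M, g, J)` is a (1,2)-symplectic almost Hermitian manifold: `(dΩ)^{1,2} = 0`, that is
`dΩ(u - iJu, v + iJv, w + iJw) = 0` for all `u`, `v`, `w`. -/
def IsOneTwoSymplectic (g : Metric E M) (J : AlmostComplexStructure E M) : Prop :=
  IsAlmostHermitian g J ∧
  ∀ p : M, ∀ x ∈ (extChartAt 𝓘(ℝ, E) p).target, ∀ u v w : E,
    complexExtension (dFundamentalForm (metricInChart g p) (complexInChart J p) x)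
      (u, -complexInChart J p x u) (v, complexInChart J p x v) (w, complexInChart J p x w) = 0

/-- The conformal metric `e^{2γ} g`. -/
def conformal (g : Metric E M) (γ : M → ℝ) (hγ : ContMDiff 𝓘(ℝ, E) 𝓘(ℝ, ℝ) ∞ γ) :
    Metric E M where
  inner p := Real.exp (2 * γ p) • g.inner p
  symm p v w := by
    change Real.exp (2 * γ p) * g.inner p v w = Real.exp (2 * γ p) * g.inner p w v
    rw [g.symm]
  pos p v hv := mul_pos (Real.exp_pos _) (g.pos p v hv)
  isVonNBounded p := by
    have h := (g.isVonNBounded p).image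
      (Real.exp (-γ p) • ContinuousLinearMap.id ℝ (TangentSpace 𝓘(ℝ, E) p))
    refine h.subset (fun v (hv : Real.exp (2 * γ p) * g.inner p v v < 1) => ?_)
    refine ⟨Real.exp (γ p) • v, ?_, ?_⟩
    · rw [two_mul, Real.exp_add] at hv
      simpa [mul_assoc] using hv
    · simp [smul_smul, ← Real.exp_add]
  contMDiff := by
    have hexp : ContMDiff 𝓘(ℝ, E) 𝓘(ℝ, ℝ) ∞ (fun p => Real.exp (2 * γ p)) :=
      (Real.contDiff_exp.comp (contDiff_const.mul contDiff_id)).contMDiff.comp hγ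
    exact hexp.smul_section g.contMDiff

end Global

section GlobalMaps

variable {E : Type*} [NormedAddCommGroup E] [NormedSpace ℝ E] [FiniteDimensional ℝ E]
  {M : Type*} [TopologicalSpace M] [ChartedSpace E M] [IsManifold 𝓘(ℝ, E) ∞ M]
  {F : Type*} [NormedAddCommGroup F] [NormedSpace ℝ F] [FiniteDimensional ℝ F]
  {N : Type*} [TopologicalSpace N] [ChartedSpace F N] [IsManifold 𝓘(ℝ, F) ∞ N]

/-- Holomorphic maps between almost complex manifolds: smooth maps with `dφ ∘ J = J ∘ dφ`. -/
def IsHolomorphic (J : AlmostComplexStructure E M) (J' : AlmostComplexStructure F N)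
    (φ : M → N) : Prop :=
  ContMDiff 𝓘(ℝ, E) 𝓘(ℝ, F) ∞ φ ∧
  ∀ (p : M) (v : TangentSpace 𝓘(ℝ, E) p),
    mfderiv 𝓘(ℝ, E) 𝓘(ℝ, F) φ p (J.toFun p v) = J'.toFun (φ p) (mfderiv 𝓘(ℝ, E) 𝓘(ℝ, F) φ p v)

/-- The bitension field `τ₂(φ)`, a section of `φ⁻¹TN`, computed at `p` in the charts around `p`
and `φ p` (which identify the tangent spaces at these points with the model spaces). -/
def bitensionField (g : Metric E M) (h : Metric F N) (φ : M → N) (p : M) :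
    TangentSpace 𝓘(ℝ, F) (φ p) :=
  bitension (E := E) (F := F) (metricInChart g p) (metricInChart h (φ p))
    (writtenInExtChartAt 𝓘(ℝ, E) 𝓘(ℝ, F) p φ) (extChartAt 𝓘(ℝ, E) p p)

/-- Biharmonic maps: smooth maps with `τ₂(φ) = 0`. -/
def IsBiharmonic (g : Metric E M) (h : Metric F N) (φ : M → N) : Prop :=
  ContMDiff 𝓘(ℝ, E) 𝓘(ℝ, F) ∞ φ ∧ ∀ p : M, bitensionField g h φ p = 0

end GlobalMaps

end BiharmonicGeometry

end

/-! The claim is local, so it is proved in charts and transferred at the end. Let `B = ∇dφ` be the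
second fundamental form with respect to the Kähler metric `g`. Since `φ` is holomorphic, `∇J = 0`
and `N` is (1,2)-symplectic, `B(Ju, Jv) = -B(u, v)` (`secondFormL_complex`); hence `B` is
trace-free. Only the change of connection contributes to the tension field for `e^{2γ}g`: it is
`dφ(X)` with `X = (m-2) e^{-2γ} grad γ` (`tension_localConformal`).

Expanding `∇²(dφ X)`, the trace of `(∇_u B)(v, X)` is, by Codazzi and the `J`-antisymmetry of `∇B`,
equal to `dφ(Ric X)` minus exactly the curvature term of `N` in the bitension field
(`trace_covDerivSecondForm`). Up to the factor `e^{-2γ}` there remain `2 tr B(·, ∇X) + (m-2) B(grad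
γ, X)` and `dφ(tr ∇²X + Ric X + (m-2) ∇_{grad γ} X)`.

Both vanish. Write `X = f V` with `V = e^{(m-6)γ/2} grad γ` and `f = (m-2) e^{-(m-2)γ/2}`, so that
`JV` is Killing. Then `∇V` is self-adjoint and `J∇V` is skew, so `∇V` commutes with `J`
(`covDeriv_commute`) and `tr B(·, ∇V) = 0`; the derivative of `f` cancels the other `B` term. A
Killing field satisfies `tr ∇²Y + Ric Y = 0`, and `J` commutes with `∇²` and `Ric`, so `V` satisfies
it too (`trace_second_covDeriv`). Passing from `V` to `fV` leaves a multiple of `V` that the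
equation for `Δγ` removes (`trace_second_covDeriv_smul`). -/

noncomputable section

set_option linter.unusedSectionVars false
set_option maxSynthPendingDepth 6

namespace BiharmonicGeometry

/-! ### Scalar products and metric traces -/

section Trace

variable {E F F' : Type*} [NormedAddCommGroup E] [NormedSpace ℝ E]
  [NormedAddCommGroup F] [NormedSpace ℝ F] [NormedAddCommGroup F'] [NormedSpace ℝ F']

/-- Scalar products on a vector space. -/
structure IsScalarProduct (B : E →L[ℝ] E →L[ℝ] ℝ) : Prop where
  symm (u v : E) : B u v = B v u
  pos (u : E) (hu : u ≠ 0) : 0 < B u u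

namespace IsScalarProduct

variable {B : E →L[ℝ] E →L[ℝ] ℝ}

theorem ext_left (hB : IsScalarProduct B) {u v : E} (h : ∀ w, B u w = B v w) : u = v := by
  by_contra hne
  have := hB.pos (u - v) (sub_ne_zero.2 hne)
  simp [h] at this

theorem smul (hB : IsScalarProduct B) {c : ℝ} (hc : 0 < c) : IsScalarProduct (c • B) where
  symm u v := by simp [hB.symm u v]
  pos u hu := by simpa using mul_pos hc (hB.pos u hu)

variable [FiniteDimensional ℝ E]

theorem isInvertible (hB : IsScalarProduct B) : B.IsInvertible := by
  have hinj : Function.Injective (B : E →ₗ[ℝ] E →L[ℝ] ℝ) := fun u v huv =>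
    hB.ext_left fun w => congrArg (fun L : E →L[ℝ] ℝ => L w) huv
  have hdim : Module.finrank ℝ E = Module.finrank ℝ (E →L[ℝ] ℝ) := by
    rw [← (LinearMap.toContinuousLinearMap (𝕜 := ℝ) (E := E) (F' := ℝ)).finrank_eq]
    exact (Subspace.dual_finrank_eq (K := ℝ) (V := E)).symm
  refine ⟨(LinearEquiv.ofInjectiveOfFinrankEq _ hinj hdim).toContinuousLinearEquiv, ?_⟩
  ext u v
  rfl

theorem inverse_apply (hB : IsScalarProduct B) (α : E →L[ℝ] ℝ) (v : E) :
    B (B.inverse α) v = α v := by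
  rw [hB.isInvertible.self_apply_inverse]

theorem exists_orthonormal (hB : IsScalarProduct B) :
    ∃ f : Fin (Module.finrank ℝ E) → E,
      (∀ i, B (f i) (f i) = 1) ∧ ∀ v, ∑ i, B v (f i) • f i = v := by
  have hsymm : LinearMap.IsSymm (ContinuousLinearMap.toBilinForm B) :=
    ⟨fun u v => by simpa using hB.symm u v⟩
  obtain ⟨e, he⟩ := LinearMap.BilinForm.exists_orthogonal_basis hsymm
  have hpos : ∀ i, 0 < B (e i) (e i) := fun i => hB.pos _ (e.ne_zero i)
  have horth : ∀ i j, i ≠ j → B (e i) (e j) = 0 := fun i j hij => by simpa using he hij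
  have hsq : ∀ i, (Real.sqrt (B (e i) (e i)))⁻¹ * (Real.sqrt (B (e i) (e i)))⁻¹ * B (e i) (e i)
      = 1 := fun i => by
    rw [← mul_inv, Real.mul_self_sqrt (hpos i).le, inv_mul_cancel₀ (hpos i).ne']
  refine ⟨fun i => (Real.sqrt (B (e i) (e i)))⁻¹ • e i, fun i => ?_, fun v => ?_⟩
  · simpa [mul_assoc] using hsq i
  · have hv := e.sum_repr v
    have hc : ∀ i, B v (e i) = e.repr v i * B (e i) (e i) := fun i => by
      conv_lhs => rw [← hv]
      simp only [map_sum, map_smul, sum_apply, smul_apply,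
        smul_eq_mul]
      refine Finset.sum_eq_single i (fun j _ hji => by rw [horth j i hji, mul_zero]) (by simp)
    conv_rhs => rw [← hv]
    refine Finset.sum_congr rfl fun i _ => ?_
    rw [map_smul, hc, smul_smul, smul_eq_mul]
    congr 1
    linear_combination (e.repr v i) * hsq i

end IsScalarProduct

variable [FiniteDimensional ℝ E]

/-- Only the reconstruction identity `hf` is used, so the trace does not depend on the basis in its
definition. Any orthonormal frame, and its image under an isometry, computes it. -/
theorem traceOf_eq_sum {G : E → E →L[ℝ] E →L[ℝ] ℝ} {x : E} (hG : IsScalarProduct (G x))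
    {f : Fin (Module.finrank ℝ E) → E} (hf : ∀ v, ∑ i, G x v (f i) • f i = v)
    (b : E →L[ℝ] E →L[ℝ] F) : traceOf G x (fun u v => b u v) = ∑ i, b (f i) (f i) := by
  have h1 : ∀ i, (G x).inverse (LinearMap.toContinuousLinearMap ((Module.finBasis ℝ E).coord i)) =
      ∑ j, (Module.finBasis ℝ E).coord i (f j) • f j := fun i => by
    conv_lhs => rw [← hf ((G x).inverse _)]
    simp [hG.inverse_apply]
  simp only [traceOf, h1, map_sum, map_smul]
  rw [Finset.sum_comm]
  refine Finset.sum_congr rfl fun j _ => ?_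
  have h2 := congrArg (fun w => b w (f j)) ((Module.finBasis ℝ E).sum_repr (f j))
  simpa only [map_sum, map_smul, sum_apply, smul_apply, Module.Basis.coord_apply] using h2

variable {G : E → E →L[ℝ] E →L[ℝ] ℝ} {x : E}

theorem traceOf_add (b c : E → E → F) :
    traceOf G x (fun u v => b u v + c u v) = traceOf G x b + traceOf G x c := by
  simp [traceOf, Finset.sum_add_distrib]

theorem traceOf_sub (b c : E → E → F) :
    traceOf G x (fun u v => b u v - c u v) = traceOf G x b - traceOf G x c := by
  simp [traceOf]

theorem traceOf_neg (b : E → E → F) :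
    traceOf G x (fun u v => -b u v) = -traceOf G x b := by
  simp [traceOf]

theorem traceOf_smul (a : ℝ) (b : E → E → F) :
    traceOf G x (fun u v => a • b u v) = a • traceOf G x b := by
  simp [traceOf, Finset.smul_sum]

theorem traceOf_clm (L : F →L[ℝ] F') (b : E → E → F) :
    traceOf G x (fun u v => L (b u v)) = L (traceOf G x b) := by
  simp [traceOf]

theorem traceOf_congr {b c : E → E → F} (h : ∀ u v, b u v = c u v) :
    traceOf G x b = traceOf G x c := by
  simp [traceOf, h]

theorem traceOf_flip (hG : IsScalarProduct (G x)) (b : E →L[ℝ] E →L[ℝ] F) :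
    traceOf G x (fun u v => b v u) = traceOf G x (fun u v => b u v) := by
  obtain ⟨f, -, hf⟩ := hG.exists_orthonormal
  rw [traceOf_eq_sum hG hf b]
  exact traceOf_eq_sum hG hf b.flip

/-- Contraction of the tensor `G(c, ·) ⊗ L`. -/
theorem traceOf_inner_smul (hG : IsScalarProduct (G x)) (c : E) (L : E →L[ℝ] F) :
    traceOf G x (fun u v => G x c u • L v) = L c := by
  obtain ⟨f, -, hf⟩ := hG.exists_orthonormal
  refine (traceOf_eq_sum hG hf ((G x c).smulRight L)).trans ?_
  conv_rhs => rw [← hf c]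
  simp

theorem traceOf_inner (hG : IsScalarProduct (G x)) :
    traceOf G x (fun u v => G x u v) = Module.finrank ℝ E := by
  obtain ⟨f, hf1, hf⟩ := hG.exists_orthonormal
  rw [traceOf_eq_sum hG hf (G x)]
  simp [hf1]

/-- The trace of a bilinear map that changes sign under an isometry vanishes. -/
theorem traceOf_eq_zero_of_isometry (hG : IsScalarProduct (G x)) (b : E →L[ℝ] E →L[ℝ] F)
    (J : E →L[ℝ] E) (hJ2 : ∀ u, J (J u) = -u) (hJ : ∀ u v, G x (J u) (J v) = G x u v)
    (hb : ∀ u v, b (J u) (J v) = -b u v) :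
    traceOf G x (fun u v => b u v) = 0 := by
  obtain ⟨f, -, hf⟩ := hG.exists_orthonormal
  -- The frame `J f` also reconstructs vectors: apply `J` to the expansion of `-J v`. Computing the
  -- trace in both frames gives `t = -t`.
  have hf' : ∀ v, ∑ i, G x v (J (f i)) • J (f i) = v := fun v => by
    have h1 := congrArg J (hf (-J v))
    simp only [map_sum, map_smul, map_neg, hJ2, neg_neg] at h1
    conv_rhs => rw [← h1]
    refine Finset.sum_congr rfl fun i _ => ?_
    have h2 := hJ (-J v) (f i)
    rw [map_neg, hJ2, neg_neg] at h2
    rw [h2, map_neg]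
  have h := traceOf_eq_sum hG hf' b
  simp only [hb, Finset.sum_neg_distrib, ← traceOf_eq_sum hG hf b] at h
  have h2 : (2 : ℝ) • traceOf G x (fun u v => b u v) = 0 := by
    rw [two_smul]
    nth_rewrite 1 [h]
    exact neg_add_cancel _
  exact (smul_eq_zero.1 h2).resolve_left two_ne_zero

theorem traceOf_smul_metric {c : ℝ} (hG : IsScalarProduct (G x)) (hc : 0 < c)
    {G' : E → E →L[ℝ] E →L[ℝ] ℝ} (hG' : G' x = c • G x) (b : E →L[ℝ] E →L[ℝ] F) :
    traceOf G' x (fun u v => b u v) = c⁻¹ • traceOf G x (fun u v => b u v) := by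
  have hs : IsScalarProduct (G' x) := hG' ▸ hG.smul hc
  have h : ∀ α, (G' x).inverse α = c⁻¹ • (G x).inverse α := fun α =>
    hs.ext_left fun w => by
      rw [hs.inverse_apply, map_smul, hG']
      simp [hG.inverse_apply, hc.ne']
  simp [traceOf, h, Finset.smul_sum]

end Trace

/-! ### Calculus of vector-valued maps -/

section Derivatives

variable {E F F' F'' : Type*} [NormedAddCommGroup E] [NormedSpace ℝ E]
  [NormedAddCommGroup F] [NormedSpace ℝ F] [NormedAddCommGroup F'] [NormedSpace ℝ F']
  [NormedAddCommGroup F''] [NormedSpace ℝ F'']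

theorem fderiv_const_apply {A : E → F →L[ℝ] F'} {x : E} (hA : DifferentiableAt ℝ A x)
    (v : F) (s : E) : fderiv ℝ (fun y => A y v) x s = fderiv ℝ A x s v := by
  rw [fderiv_clm_apply hA (differentiableAt_const v)]
  simp

theorem fderiv_apply_field {A : E → F →L[ℝ] F'} {X : E → F} {x : E}
    (hA : DifferentiableAt ℝ A x) (hX : DifferentiableAt ℝ X x) (s : E) :
    fderiv ℝ (fun y => A y (X y)) x s = fderiv ℝ A x s (X x) + A x (fderiv ℝ X x s) := by
  rw [fderiv_clm_apply hA hX]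
  simp [add_comm]

theorem fderiv_apply_field₂ {A : E → F →L[ℝ] F'' →L[ℝ] F'} {X : E → F} {Y : E → F''} {x : E}
    (hA : DifferentiableAt ℝ A x) (hX : DifferentiableAt ℝ X x) (hY : DifferentiableAt ℝ Y x)
    (s : E) :
    fderiv ℝ (fun y => A y (X y) (Y y)) x s =
      fderiv ℝ A x s (X x) (Y x) + A x (fderiv ℝ X x s) (Y x) + A x (X x) (fderiv ℝ Y x s) := by
  rw [fderiv_apply_field (hA.clm_apply hX) hY, fderiv_apply_field hA hX]
  rfl

theorem contDiffAt_fderiv {f : E → F} {x : E} (hf : ContDiffAt ℝ ∞ f x) :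
    ContDiffAt ℝ ∞ (fderiv ℝ f) x := hf.fderiv_right (by simp)

theorem diffAt {f : E → F} {x : E} (hf : ContDiffAt ℝ ∞ f x) : DifferentiableAt ℝ f x :=
  hf.differentiableAt (by simp)

theorem fderiv_fderiv_symm {f : E → F} {x : E} (hf : ContDiffAt ℝ ∞ f x) (u v : E) :
    fderiv ℝ (fderiv ℝ f) x u v = fderiv ℝ (fderiv ℝ f) x v u :=
  (hf.isSymmSndFDerivAt (by
    rw [minSmoothness_of_isRCLikeNormedField]
    exact WithTop.coe_le_coe.2 le_top)) u v

/-- The device by which pointwise tensor identities on an open set are differentiated throughout. -/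
theorem fderiv_eq_of_eqOn {U : Set E} (hU : IsOpen U) {f g : E → F} {x : E} (hx : x ∈ U)
    (h : ∀ y ∈ U, f y = g y) : fderiv ℝ f x = fderiv ℝ g x :=
  Filter.EventuallyEq.fderiv_eq (Filter.eventually_of_mem (hU.mem_nhds hx) h)

end Derivatives

/-! ### Levi-Civita connection and curvature symmetries in coordinates -/

section Metric

variable {E : Type*} [NormedAddCommGroup E] [NormedSpace ℝ E] [FiniteDimensional ℝ E]

/-- Smooth Riemannian metrics on an open set. -/
structure IsLocalMetric (U : Set E) (G : E → E →L[ℝ] E →L[ℝ] ℝ) : Prop where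
  isOpen : IsOpen U
  contDiffAt (x : E) (hx : x ∈ U) : ContDiffAt ℝ ∞ G x
  scalarProduct (x : E) (hx : x ∈ U) : IsScalarProduct (G x)

/-- The Christoffel symbols as a bilinear map. -/
def christoffelL (G : E → E →L[ℝ] E →L[ℝ] ℝ) (x : E) : E →L[ℝ] E →L[ℝ] E :=
  (ContinuousLinearMap.compL ℝ E (E →L[ℝ] ℝ) E (G x).inverse) ∘L ((1 / 2 : ℝ) •
    (fderiv ℝ G x + (fderiv ℝ G x).flip -
      (ContinuousLinearMap.flipₗᵢ ℝ E E ℝ).toContinuousLinearEquiv.toContinuousLinearMap ∘L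
        (fderiv ℝ G x).flip))

theorem christoffelL_apply (G : E → E →L[ℝ] E →L[ℝ] ℝ) (x u v : E) :
    christoffelL G x u v = christoffel G x u v := rfl

/-- The curvature of a connection with Christoffel symbols `Γ`. -/
def curvatureOf (Γ : E → E →L[ℝ] E →L[ℝ] E) (x u v w : E) : E :=
  fderiv ℝ Γ x u v w - fderiv ℝ Γ x v u w + Γ x u (Γ x v w) - Γ x v (Γ x u w)

namespace IsLocalMetric

variable {U : Set E} {G : E → E →L[ℝ] E →L[ℝ] ℝ} {x : E}

theorem contDiffAt_inverse (hG : IsLocalMetric U G) (hx : x ∈ U) :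
    ContDiffAt ℝ ∞ (fun y => (G y).inverse) x :=
  ((hG.scalarProduct x hx).isInvertible.contDiffAt_map_inverse).comp x (hG.contDiffAt x hx)

theorem contDiffAt_christoffelL (hG : IsLocalMetric U G) (hx : x ∈ U) :
    ContDiffAt ℝ ∞ (christoffelL G) x := by
  have h1 := contDiffAt_fderiv (hG.contDiffAt x hx)
  have h2 := hG.contDiffAt_inverse hx
  have h3 : ContDiffAt ℝ ∞ (fun y => (fderiv ℝ G y).flip) x :=
    (ContinuousLinearMap.flipₗᵢ ℝ E E (E →L[ℝ] ℝ)).contDiff.contDiffAt.comp x h1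
  exact ((ContinuousLinearMap.compL ℝ E (E →L[ℝ] ℝ) E).contDiff.contDiffAt.comp x h2).clm_comp
    (((h1.add h3).sub (contDiffAt_const.clm_comp h3)).const_smul (1 / 2 : ℝ))

theorem fderiv_symm (hG : IsLocalMetric U G) (hx : x ∈ U) (s u v : E) :
    fderiv ℝ G x s u v = fderiv ℝ G x s v u := by
  have hd := diffAt (hG.contDiffAt x hx)
  have h := fderiv_eq_of_eqOn hG.isOpen hx
    (fun y hy => (hG.scalarProduct y hy).symm u v)
  have h := congrArg (fun L : E →L[ℝ] ℝ => L s) h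
  have h1 (w : E) : DifferentiableAt ℝ (fun y => G y w) x := hd.clm_apply (differentiableAt_const w)
  simpa only [fderiv_const_apply (h1 _), fderiv_const_apply hd] using h

theorem christoffelL_symm (hG : IsLocalMetric U G) (hx : x ∈ U) (u v : E) :
    christoffelL G x u v = christoffelL G x v u := by
  simp only [christoffelL_apply, christoffel]
  congr 2
  ext z
  simp [hG.fderiv_symm hx z u v, add_comm]

/-- The Koszul formula. -/
theorem inner_christoffelL (hG : IsLocalMetric U G) (hx : x ∈ U) (u v z : E) :
    G x (christoffelL G x u v) z = (1 / 2 : ℝ) *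
      (fderiv ℝ G x u v z + fderiv ℝ G x v u z - fderiv ℝ G x z u v) := by
  rw [christoffelL_apply, christoffel, (hG.scalarProduct x hx).inverse_apply]
  simp

/-- Metric compatibility `∇G = 0`, in the form that trades every derivative of `G` for Christoffel
terms. -/
theorem fderiv_eq (hG : IsLocalMetric U G) (hx : x ∈ U) (s u v : E) :
    fderiv ℝ G x s u v = G x (christoffelL G x s u) v + G x u (christoffelL G x s v) := by
  rw [(hG.scalarProduct x hx).symm u, hG.inner_christoffelL hx, hG.inner_christoffelL hx]
  linarith [hG.fderiv_symm hx s u v, hG.fderiv_symm hx u v s, hG.fderiv_symm hx v u s]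

theorem fderiv_christoffelL_symm (hG : IsLocalMetric U G) (hx : x ∈ U) (s u v : E) :
    fderiv ℝ (christoffelL G) x s u v = fderiv ℝ (christoffelL G) x s v u := by
  have hd := diffAt (hG.contDiffAt_christoffelL hx)
  have h := congrArg (fun L : E →L[ℝ] E => L s)
    (fderiv_eq_of_eqOn hG.isOpen hx (fun y hy => hG.christoffelL_symm hy u v))
  have h1 (w : E) : DifferentiableAt ℝ (fun y => christoffelL G y w) x :=
    hd.clm_apply (differentiableAt_const w)
  simpa only [fderiv_const_apply (h1 _), fderiv_const_apply hd] using h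

theorem curvature_eq (hG : IsLocalMetric U G) (hx : x ∈ U) (u v w : E) :
    curvature G x u v w = curvatureOf (christoffelL G) x u v w := by
  have hd := diffAt (hG.contDiffAt_christoffelL hx)
  have h1 (w : E) : DifferentiableAt ℝ (fun y => christoffelL G y w) x :=
    hd.clm_apply (differentiableAt_const w)
  simp only [curvature, curvatureOf, ← christoffelL_apply, fderiv_const_apply (h1 _),
    fderiv_const_apply hd]

theorem curvature_antisymm (Γ : E → E →L[ℝ] E →L[ℝ] E) (x u v w : E) :
    curvatureOf Γ x u v w = -curvatureOf Γ x v u w := by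
  simp only [curvatureOf]
  abel

theorem bianchi (hG : IsLocalMetric U G) (hx : x ∈ U) (u v w : E) :
    curvatureOf (christoffelL G) x u v w + curvatureOf (christoffelL G) x v w u
      + curvatureOf (christoffelL G) x w u v = 0 := by
  simp only [curvatureOf]
  rw [hG.fderiv_christoffelL_symm hx u w v, hG.fderiv_christoffelL_symm hx v w u,
    hG.fderiv_christoffelL_symm hx w v u, hG.christoffelL_symm hx w v, hG.christoffelL_symm hx u w,
    hG.christoffelL_symm hx u v]
  abel

theorem inner_curvature_skew (hG : IsLocalMetric U G) (hx : x ∈ U) (s u v w : E) :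
    G x (curvatureOf (christoffelL G) x s u v) w = -G x v (curvatureOf (christoffelL G) x s u w) := by
  have hd := diffAt (hG.contDiffAt x hx)
  have hd' := diffAt (contDiffAt_fderiv (hG.contDiffAt x hx))
  have hc := diffAt (hG.contDiffAt_christoffelL hx)
  have hx1 (a : E) : DifferentiableAt ℝ (fun y => G y a) x := hd.clm_apply (by fun_prop)
  have hcG (a b : E) : DifferentiableAt ℝ (fun y => G y (christoffelL G y a b)) x :=
    hd.clm_apply (by fun_prop)
  have hc1 (a b : E) : DifferentiableAt ℝ (fun y => christoffelL G y a b) x := by fun_prop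
  -- The derivative of the metric compatibility identity. Its left side is symmetric in `s` and `u`;
  -- antisymmetrizing the right side produces the curvature.
  have key (s u : E) : fderiv ℝ (fderiv ℝ G) x s u v w =
      fderiv ℝ G x s (christoffelL G x u v) w + G x (fderiv ℝ (christoffelL G) x s u v) w +
      (fderiv ℝ G x s v (christoffelL G x u w) + G x v (fderiv ℝ (christoffelL G) x s u w)) := by
    have h := congrArg (fun L : E →L[ℝ] ℝ => L s)
      (fderiv_eq_of_eqOn hG.isOpen hx (fun y hy => hG.fderiv_eq hy u v w))
    rw [fderiv_fun_add (by fun_prop) (by fun_prop), add_apply,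
      fderiv_apply_field₂ hd (hc1 _ _) (by fun_prop), fderiv_apply_field₂ hd (by fun_prop) (hc1 _ _),
      fderiv_const_apply (by fun_prop), fderiv_const_apply (by fun_prop),
      fderiv_const_apply (by fun_prop), fderiv_const_apply (by fun_prop),
      fderiv_const_apply (by fun_prop), fderiv_const_apply (by fun_prop),
      fderiv_const_apply (by fun_prop)] at h
    simpa using h
  have h1 := key s u
  have h2 := key u s
  have h3 := congrArg (fun L : E →L[ℝ] E →L[ℝ] ℝ => L v w)
    (fderiv_fderiv_symm (hG.contDiffAt x hx) s u)
  simp only [hG.fderiv_eq hx] at h1 h2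
  simp only [curvatureOf, map_add, map_sub, add_apply, sub_apply]
  linarith

/-- The classical octahedron argument: four Bianchi identities combined with the skew symmetry in
each pair of arguments. -/
theorem inner_curvature_pair_symm (hG : IsLocalMetric U G) (hx : x ∈ U) (s u v w : E) :
    G x (curvatureOf (christoffelL G) x s u v) w = G x (curvatureOf (christoffelL G) x v w s) u := by
  set R := curvatureOf (christoffelL G) x
  have sk (s u v w) : G x (R s u v) w = -G x (R s u w) v := by
    rw [hG.inner_curvature_skew hx, (hG.scalarProduct x hx).symm]
  have an (s u v w) : G x (R s u v) w = -G x (R u s v) w := by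
    simp only [R]; rw [curvature_antisymm]; simp
  have bi (u v w z) : G x (R u v w) z + G x (R v w u) z + G x (R w u v) z = 0 := by
    rw [← add_apply, ← map_add, ← add_apply, ← map_add, hG.bianchi hx]; simp
  linarith [bi s u v w, bi u v w s, bi v w s u, bi w s u v, sk s u v w, sk u v s w, sk v s u w,
    sk u v w s, sk v w u s, sk w u v s, sk v w s u, sk w s v u, sk s v w u, sk w s u v, sk s u w v,
    sk u w s v, an s u v w, an s u w v, an u v s w, an u v w s, an v s u w, an v s w u,
    an w u v s, an w u s v, an v w s u, an v w u s, an w s u v, an w s v u]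

end IsLocalMetric

end Metric

/-! ### Traces of unbundled bilinear maps -/

section BilinearTrace

variable {E F : Type*} [NormedAddCommGroup E] [NormedSpace ℝ E] [FiniteDimensional ℝ E]
  [NormedAddCommGroup F] [NormedSpace ℝ F]

/-- `traceOf` accepts arbitrary functions, but its invariance needs bilinearity. In finite dimension
continuity is automatic, so proving `IsBilinearMap` suffices. -/
theorem exists_clm_of_isBilinearMap {b : E → E → F} (hb : IsBilinearMap ℝ b) :
    ∃ c : E →L[ℝ] E →L[ℝ] F, b = fun u v => c u v :=
  ⟨LinearMap.toContinuousLinearMap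
    ((LinearMap.toContinuousLinearMap (𝕜 := ℝ) (E := E) (F' := F)).toLinearMap ∘ₗ hb.toLinearMap),
    rfl⟩

variable {G : E → E →L[ℝ] E →L[ℝ] ℝ} {x : E} {b : E → E → F}

theorem traceOf_swap (hG : IsScalarProduct (G x)) (hb : IsBilinearMap ℝ b) :
    traceOf G x (fun u v => b v u) = traceOf G x b := by
  obtain ⟨c, rfl⟩ := exists_clm_of_isBilinearMap hb
  exact traceOf_flip hG c

theorem traceOf_eq_zero (hG : IsScalarProduct (G x)) (hb : IsBilinearMap ℝ b)
    (J : E →L[ℝ] E) (hJ2 : ∀ u, J (J u) = -u) (hJ : ∀ u v, G x (J u) (J v) = G x u v)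
    (h : ∀ u v, b (J u) (J v) = -b u v) : traceOf G x b = 0 := by
  obtain ⟨c, rfl⟩ := exists_clm_of_isBilinearMap hb
  exact traceOf_eq_zero_of_isometry hG c J hJ2 hJ h

theorem traceOf_conformal {c : ℝ} (hG : IsScalarProduct (G x)) (hc : 0 < c)
    {G' : E → E →L[ℝ] E →L[ℝ] ℝ} (hG' : G' x = c • G x) (hb : IsBilinearMap ℝ b) :
    traceOf G' x b = c⁻¹ • traceOf G x b := by
  obtain ⟨c, rfl⟩ := exists_clm_of_isBilinearMap hb
  exact traceOf_smul_metric hG hc hG' c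

end BilinearTrace

/-! ### Killing fields and Kähler curvature -/

section VectorFields

variable {E : Type*} [NormedAddCommGroup E] [NormedSpace ℝ E] [FiniteDimensional ℝ E]

/-- The covariant derivative `∇X` of a vector field. -/
def covDeriv (G : E → E →L[ℝ] E →L[ℝ] ℝ) (X : E → E) (x : E) : E →L[ℝ] E :=
  fderiv ℝ X x + (christoffelL G x).flip (X x)

theorem covDeriv_apply (G : E → E →L[ℝ] E →L[ℝ] ℝ) (X : E → E) (x u : E) :
    covDeriv G X x u = fderiv ℝ X x u + christoffelL G x u (X x) := rfl

theorem isBilinearMap_covDerivEnd (G : E → E →L[ℝ] E →L[ℝ] ℝ) (A : E → E →L[ℝ] E) (x : E) :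
    IsBilinearMap ℝ (covDerivEnd G A x) := by
  constructor <;> intros <;> simp only [covDerivEnd, ← christoffelL_apply, map_add, map_smul,
    add_apply, smul_apply, smul_add, smul_sub] <;> abel

theorem isBilinearMap_curvatureOf (Γ : E → E →L[ℝ] E →L[ℝ] E) (x w : E) :
    IsBilinearMap ℝ (curvatureOf Γ x w) := by
  constructor <;> intros <;> simp only [curvatureOf, map_add, map_smul,
    add_apply, smul_apply, smul_add, smul_sub] <;> abel

namespace IsLocalMetric

variable {U : Set E} {G : E → E →L[ℝ] E →L[ℝ] ℝ} {x : E} {X : E → E}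

theorem contDiffAt_covDeriv (hG : IsLocalMetric U G) (hx : x ∈ U) (hX : ContDiffAt ℝ ∞ X x) :
    ContDiffAt ℝ ∞ (covDeriv G X) x :=
  (contDiffAt_fderiv hX).add
    (((ContinuousLinearMap.flipₗᵢ ℝ E E E).contDiff.contDiffAt.comp x
      (hG.contDiffAt_christoffelL hx)).clm_apply hX)

theorem fderiv_covDeriv (hG : IsLocalMetric U G) (hx : x ∈ U) (hX : ContDiffAt ℝ ∞ X x) (s u : E) :
    fderiv ℝ (covDeriv G X) x s u = fderiv ℝ (fderiv ℝ X) x s u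
      + fderiv ℝ (christoffelL G) x s u (X x) + christoffelL G x u (fderiv ℝ X x s) := by
  have hX1 := diffAt hX
  have hX2 := diffAt (contDiffAt_fderiv hX)
  have hc := diffAt (hG.contDiffAt_christoffelL hx)
  have hcu : DifferentiableAt ℝ (fun y => christoffelL G y u) x := by fun_prop
  rw [← fderiv_const_apply (diffAt (hG.contDiffAt_covDeriv hx hX))]
  simp only [covDeriv_apply]
  rw [fderiv_fun_add (by fun_prop) (hcu.clm_apply hX1), add_apply, fderiv_const_apply hX2,
    fderiv_apply_field hcu hX1, fderiv_const_apply hc, add_assoc]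

/-- Here `covDerivEnd G (covDeriv G X)` is the second covariant derivative `∇²X`. Second derivatives
commute and the torsion is zero, so only curvature survives the antisymmetrization. -/
theorem ricci_identity (hG : IsLocalMetric U G) (hx : x ∈ U) (hX : ContDiffAt ℝ ∞ X x) (s u : E) :
    covDerivEnd G (covDeriv G X) x s u - covDerivEnd G (covDeriv G X) x u s =
      curvatureOf (christoffelL G) x s u (X x) := by
  simp only [covDerivEnd, curvatureOf, ← christoffelL_apply, hG.fderiv_covDeriv hx hX,
    covDeriv_apply, map_add]
  rw [fderiv_fderiv_symm hX u s, hG.christoffelL_symm hx u s]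
  abel

theorem inner_covDeriv_skew (hG : IsLocalMetric U G) (hx : x ∈ U)
    (hK : ∀ u v, lieDerivMetric G X x u v = 0) (u v : E) :
    G x (covDeriv G X x u) v + G x u (covDeriv G X x v) = 0 := by
  have h := hK u v
  rw [lieDerivMetric, hG.fderiv_eq hx] at h
  simp only [covDeriv_apply, map_add, add_apply, hG.christoffelL_symm hx _ (X x)]
  linarith

/-- The covariant derivative of the Killing equation: if `∇X` is skew on an open set, so is each
`∇_s ∇X`, because `G` is parallel. -/
theorem inner_second_covDeriv_skew (hG : IsLocalMetric U G) (hX : ∀ y ∈ U, ContDiffAt ℝ ∞ X y)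
    (hK : ∀ y ∈ U, ∀ u v, lieDerivMetric G X y u v = 0) (hx : x ∈ U) (s u v : E) :
    G x (covDerivEnd G (covDeriv G X) x s u) v
      + G x u (covDerivEnd G (covDeriv G X) x s v) = 0 := by
  have hd := diffAt (hG.contDiffAt x hx)
  have hA := diffAt (hG.contDiffAt_covDeriv hx (hX x hx))
  have hA1 (a : E) : DifferentiableAt ℝ (fun y => covDeriv G X y a) x :=
    hA.clm_apply (differentiableAt_const a)
  have h1 : DifferentiableAt ℝ (fun y => G y (covDeriv G X y u) v) x :=
    (hd.clm_apply (hA1 u)).clm_apply (differentiableAt_const v)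
  have h2 : DifferentiableAt ℝ (fun y => G y u (covDeriv G X y v)) x :=
    (hd.clm_apply (differentiableAt_const u)).clm_apply (hA1 v)
  have h := congrArg (fun L : E →L[ℝ] ℝ => L s)
    (fderiv_eq_of_eqOn hG.isOpen hx (fun y hy => hG.inner_covDeriv_skew hy (hK y hy) u v))
  rw [fderiv_fun_add h1 h2, add_apply,
    fderiv_apply_field₂ hd (hA1 u) (differentiableAt_const v),
    fderiv_apply_field₂ hd (differentiableAt_const u) (hA1 v),
    fderiv_const_apply hA, fderiv_const_apply hA] at h
  simp only [hG.fderiv_eq hx, fderiv_fun_const, Pi.zero_apply, zero_apply, map_zero] at h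
  simp only [covDerivEnd, ← christoffelL_apply, map_add, map_sub, add_apply, sub_apply]
  have e1 := hG.inner_covDeriv_skew hx (hK x hx) (christoffelL G x s u) v
  have e2 := hG.inner_covDeriv_skew hx (hK x hx) u (christoffelL G x s v)
  linarith

/-- Killing vector fields satisfy `∇²_{s,u} X = -R(X, s) u`. -/
theorem second_covDeriv_of_killing (hG : IsLocalMetric U G) (hX : ∀ y ∈ U, ContDiffAt ℝ ∞ X y)
    (hK : ∀ y ∈ U, ∀ u v, lieDerivMetric G X y u v = 0) (hx : x ∈ U) (s u : E) :
    covDerivEnd G (covDeriv G X) x s u = -curvatureOf (christoffelL G) x (X x) s u := by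
  refine (hG.scalarProduct x hx).ext_left fun v => ?_
  have sk (s u v : E) : G x (covDerivEnd G (covDeriv G X) x s u) v =
      -G x (covDerivEnd G (covDeriv G X) x s v) u := by
    linarith [hG.inner_second_covDeriv_skew hX hK hx s u v,
      (hG.scalarProduct x hx).symm u (covDerivEnd G (covDeriv G X) x s v)]
  have ri (s u v : E) := congrArg (fun w => G x w v) (hG.ricci_identity hx (hX x hx) s u)
  have rs (s u v w : E) : G x (curvatureOf (christoffelL G) x s u v) w =
      -G x (curvatureOf (christoffelL G) x s u w) v := by
    rw [hG.inner_curvature_skew hx, (hG.scalarProduct x hx).symm]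
  have bi := congrArg (fun w => G x w (X x)) (hG.bianchi hx s u v)
  simp only [map_add, add_apply, map_zero, zero_apply, map_sub, sub_apply] at bi ri
  rw [map_neg, neg_apply, hG.inner_curvature_pair_symm hx (X x) s u v]
  -- A form `T(s,u,v)` skew in its last two arguments is determined by its antisymmetrization in the
  -- first two, by the same cyclic sum as in the Koszul formula. The Ricci identity supplies that
  -- antisymmetrization, and Bianchi merges the three curvature terms into one.
  linarith [sk s u v, sk u s v, sk v u s, sk s v u, sk v s u, sk u v s, ri s u v, ri u v s, ri v s u,
    rs s u v (X x), rs u v s (X x), rs v s u (X x)]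

end IsLocalMetric

/-- Smooth almost Hermitian structures on an open set. -/
structure IsLocalHermitian (U : Set E) (G : E → E →L[ℝ] E →L[ℝ] ℝ) (J : E → E →L[ℝ] E) : Prop
    extends IsLocalMetric U G where
  contDiffAt_complex (x : E) (hx : x ∈ U) : ContDiffAt ℝ ∞ J x
  sq_neg (x : E) (hx : x ∈ U) (u : E) : J x (J x u) = -u
  isometry (x : E) (hx : x ∈ U) (u v : E) : G x (J x u) (J x v) = G x u v

/-- Kähler structures on an open set. -/
structure IsLocalKahler (U : Set E) (G : E → E →L[ℝ] E →L[ℝ] ℝ) (J : E → E →L[ℝ] E) : Prop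
    extends IsLocalHermitian U G J where
  parallel (x : E) (hx : x ∈ U) (u v : E) : covDerivEnd G J x u v = 0

namespace IsLocalHermitian

variable {U : Set E} {G : E → E →L[ℝ] E →L[ℝ] ℝ} {J : E → E →L[ℝ] E} {x : E}

theorem inner_complex_left (hJ : IsLocalHermitian U G J) (hx : x ∈ U) (u v : E) :
    G x (J x u) v = -G x u (J x v) := by
  have h := hJ.isometry x hx u (J x v)
  rw [hJ.sq_neg x hx, map_neg] at h
  linarith

end IsLocalHermitian

namespace IsLocalKahler

variable {U : Set E} {G : E → E →L[ℝ] E →L[ℝ] ℝ} {J : E → E →L[ℝ] E} {x : E} {V : E → E}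

theorem fderiv_complex (hJ : IsLocalKahler U G J) (hx : x ∈ U) (u v : E) :
    fderiv ℝ J x u v = J x (christoffelL G x u v) - christoffelL G x u (J x v) := by
  have h := hJ.parallel x hx u v
  rw [covDerivEnd, ← christoffelL_apply, ← christoffelL_apply] at h
  rw [eq_sub_iff_add_eq]
  exact sub_eq_zero.1 h

/-- Differentiating `∇J = 0` once more and using the symmetry of the second derivative of `J` shows
that `R(s,u)` commutes with `J`. -/
theorem curvature_complex (hJ : IsLocalKahler U G J) (hx : x ∈ U) (s u v : E) :
    curvatureOf (christoffelL G) x s u (J x v) = J x (curvatureOf (christoffelL G) x s u v) := by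
  have hd := diffAt (hJ.contDiffAt_complex x hx)
  have hd' := diffAt (contDiffAt_fderiv (hJ.contDiffAt_complex x hx))
  have hc := diffAt (hJ.contDiffAt_christoffelL hx)
  have hJv : DifferentiableAt ℝ (fun y => J y v) x := by fun_prop
  have key (s u : E) : fderiv ℝ (fderiv ℝ J) x s u v =
      fderiv ℝ J x s (christoffelL G x u v) + J x (fderiv ℝ (christoffelL G) x s u v) -
      (fderiv ℝ (christoffelL G) x s u (J x v) + christoffelL G x u (fderiv ℝ J x s v)) := by
    have hcu : DifferentiableAt ℝ (fun y => christoffelL G y u) x := by fun_prop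
    have hcuv : DifferentiableAt ℝ (fun y => christoffelL G y u v) x := by fun_prop
    have hDu : DifferentiableAt ℝ (fun y => fderiv ℝ J y u) x := by fun_prop
    have h := congrArg (fun L : E →L[ℝ] E => L s)
      (fderiv_eq_of_eqOn hJ.isOpen hx (fun y hy => hJ.fderiv_complex hy u v))
    rwa [fderiv_fun_sub (hd.clm_apply hcuv) (hcu.clm_apply hJv), sub_apply,
      fderiv_apply_field hd hcuv, fderiv_apply_field hcu hJv, fderiv_const_apply hDu,
      fderiv_const_apply hd', fderiv_const_apply hcu, fderiv_const_apply hc,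
      fderiv_const_apply hd] at h
  have h := congrArg (fun L : E →L[ℝ] E => L v)
    (fderiv_fderiv_symm (hJ.contDiffAt_complex x hx) s u)
  simp only [key, hJ.fderiv_complex hx, map_sub] at h
  simp only [curvatureOf, map_add, map_sub]
  rw [← sub_eq_zero] at h ⊢
  rw [← neg_eq_zero, ← h]
  abel

/-- Pair symmetry carries the `J`-invariance from the last two arguments to the first two. -/
theorem curvature_complex_complex (hJ : IsLocalKahler U G J) (hx : x ∈ U) (s u v : E) :
    curvatureOf (christoffelL G) x (J x s) (J x u) v = curvatureOf (christoffelL G) x s u v := by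
  refine (hJ.scalarProduct x hx).ext_left fun w => ?_
  rw [hJ.inner_curvature_pair_symm hx, hJ.curvature_complex hx, hJ.isometry x hx,
    hJ.inner_curvature_pair_symm hx]

/-- The Ricci endomorphism commutes with `J`: the form `R(Jw,u)v - J R(w,u)v` changes sign when `J`
is applied to both `u` and `v`, so it is trace-free. -/
theorem trace_curvature_complex (hJ : IsLocalKahler U G J) (hx : x ∈ U) (w : E) :
    traceOf G x (curvatureOf (christoffelL G) x (J x w)) =
      J x (traceOf G x (curvatureOf (christoffelL G) x w)) := by
  rw [← traceOf_clm (J x), ← sub_eq_zero, ← traceOf_sub]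
  have h1 (u v : E) : curvatureOf (christoffelL G) x w (J x u) v =
      -curvatureOf (christoffelL G) x (J x w) u v := by
    rw [← hJ.curvature_complex_complex hx, hJ.sq_neg x hx]
    exact ((isBilinearMap_curvatureOf _ x (J x w)).toLinearMap.map_neg₂ u v)
  refine traceOf_eq_zero (hJ.scalarProduct x hx) ?_ (J x) (hJ.sq_neg x hx) (hJ.isometry x hx) ?_
  · have hb := isBilinearMap_curvatureOf (christoffelL G) x (J x w)
    have hb' := isBilinearMap_curvatureOf (christoffelL G) x w
    constructor <;> intros <;> simp only [hb.add_left, hb.add_right, hb'.add_left, hb'.add_right,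
      hb.smul_left, hb.smul_right, hb'.smul_left, hb'.smul_right, map_add, map_smul, smul_sub] <;>
      abel
  · intro u v
    rw [hJ.curvature_complex_complex hx, hJ.curvature_complex hx, hJ.curvature_complex hx, h1,
      map_neg, map_neg, hJ.sq_neg x hx]
    abel

theorem covDeriv_complex (hJ : IsLocalKahler U G J) (hx : x ∈ U) (hV : ContDiffAt ℝ ∞ V x) (u : E) :
    covDeriv G (fun y => J y (V y)) x u = J x (covDeriv G V x u) := by
  rw [covDeriv_apply, fderiv_apply_field (diffAt (hJ.contDiffAt_complex x hx)) (diffAt hV),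
    hJ.fderiv_complex hx, covDeriv_apply, map_add]
  abel

theorem second_covDeriv_complex (hJ : IsLocalKahler U G J) (hx : x ∈ U)
    (hV : ∀ y ∈ U, ContDiffAt ℝ ∞ V y) (s u : E) :
    covDerivEnd G (covDeriv G (fun y => J y (V y))) x s u =
      J x (covDerivEnd G (covDeriv G V) x s u) := by
  have hd := diffAt (hJ.contDiffAt_complex x hx)
  have hA := diffAt (hJ.contDiffAt_covDeriv hx (hV x hx))
  have hA' := diffAt (hJ.contDiffAt_covDeriv hx
    ((hJ.contDiffAt_complex x hx).clm_apply (hV x hx)))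
  have h := congrArg (fun L : E →L[ℝ] E => L s)
    (fderiv_eq_of_eqOn hJ.isOpen hx (fun y hy => hJ.covDeriv_complex hy (hV y hy) u))
  rw [fderiv_const_apply hA', fderiv_apply_field hd (hA.clm_apply (differentiableAt_const u)),
    fderiv_const_apply hA, hJ.fderiv_complex hx] at h
  rw [covDerivEnd, covDerivEnd, h, hJ.covDeriv_complex hx (hV x hx),
    hJ.covDeriv_complex hx (hV x hx), ← christoffelL_apply, ← christoffelL_apply]
  simp only [← christoffelL_apply, map_add, map_sub]
  abel

/-- If `JV` is a Killing vector field, then `trace ∇²V + Ric V = 0`. -/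
theorem trace_second_covDeriv (hJ : IsLocalKahler U G J) (hV : ∀ y ∈ U, ContDiffAt ℝ ∞ V y)
    (hK : ∀ y ∈ U, ∀ u v, lieDerivMetric G (fun y => J y (V y)) y u v = 0) (hx : x ∈ U) :
    traceOf G x (covDerivEnd G (covDeriv G V) x) =
      -traceOf G x (curvatureOf (christoffelL G) x (V x)) := by
  -- As `J` is parallel, `∇²(JV) = J∇²V`, and the Killing formula applies to `JV`. After tracing,
  -- `J` factors out of both sides.
  have h1 (s u : E) : J x (covDerivEnd G (covDeriv G V) x s u) =
      -curvatureOf (christoffelL G) x (J x (V x)) s u := by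
    rw [← hJ.second_covDeriv_complex hx hV]
    exact hJ.second_covDeriv_of_killing
      (fun y hy => (hJ.contDiffAt_complex y hy).clm_apply (hV y hy)) hK hx s u
  have h2 := traceOf_congr (G := G) (x := x) h1
  rw [traceOf_clm (J x), traceOf_neg, hJ.trace_curvature_complex hx] at h2
  have h3 := congrArg (J x) h2
  rw [hJ.sq_neg x hx, map_neg, hJ.sq_neg x hx, neg_inj] at h3
  exact h3

end IsLocalKahler

end VectorFields

/-! ### Gradients, conformal change and the field `e^{aγ} grad γ` -/

section Gradient

variable {E : Type*} [NormedAddCommGroup E] [NormedSpace ℝ E] [FiniteDimensional ℝ E]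

/-- The gradient of a function in coordinates. -/
def localGrad (G : E → E →L[ℝ] E →L[ℝ] ℝ) (f : E → ℝ) (x : E) : E := (G x).inverse (fderiv ℝ f x)

/-- A conformal metric in coordinates. -/
def localConformal (G : E → E →L[ℝ] E →L[ℝ] ℝ) (f : E → ℝ) (x : E) : E →L[ℝ] E →L[ℝ] ℝ :=
  Real.exp (2 * f x) • G x

namespace IsLocalMetric

variable {U : Set E} {G : E → E →L[ℝ] E →L[ℝ] ℝ} {x : E} {f γ : E → ℝ} {X : E → E}

theorem inner_localGrad (hG : IsLocalMetric U G) (hx : x ∈ U) (v : E) :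
    G x (localGrad G f x) v = fderiv ℝ f x v := (hG.scalarProduct x hx).inverse_apply _ _

theorem contDiffAt_localGrad (hG : IsLocalMetric U G) (hx : x ∈ U) (hf : ContDiffAt ℝ ∞ f x) :
    ContDiffAt ℝ ∞ (localGrad G f) x := (hG.contDiffAt_inverse hx).clm_apply (contDiffAt_fderiv hf)

theorem hessian_eq (hf : ContDiffAt ℝ ∞ f x) (u v : E) :
    hessian G f x u v = fderiv ℝ (fderiv ℝ f) x u v - fderiv ℝ f x (christoffelL G x u v) := by
  rw [hessian, fderiv_const_apply (diffAt (contDiffAt_fderiv hf)), christoffelL_apply]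

theorem hessian_symm (hG : IsLocalMetric U G) (hx : x ∈ U) (hf : ContDiffAt ℝ ∞ f x) (u v : E) :
    hessian G f x u v = hessian G f x v u := by
  rw [hessian_eq hf, hessian_eq hf, fderiv_fderiv_symm hf, hG.christoffelL_symm hx]

theorem inner_covDeriv_localGrad (hG : IsLocalMetric U G) (hx : x ∈ U)
    (hf : ∀ y ∈ U, ContDiffAt ℝ ∞ f y) (u v : E) :
    G x (covDeriv G (localGrad G f) x u) v = hessian G f x u v := by
  have hd := diffAt (hG.contDiffAt x hx)
  have hg := diffAt (hG.contDiffAt_localGrad hx (hf x hx))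
  have h := congrArg (fun L : E →L[ℝ] ℝ => L u)
    (fderiv_eq_of_eqOn hG.isOpen hx (fun y hy => hG.inner_localGrad (f := f) hy v))
  rw [fderiv_apply_field₂ hd hg (differentiableAt_const v),
    fderiv_const_apply (diffAt (contDiffAt_fderiv (hf x hx))), hG.fderiv_eq hx] at h
  simp only [fderiv_fun_const, Pi.zero_apply, zero_apply, map_zero] at h
  rw [hessian_eq (hf x hx), ← h, covDeriv_apply, map_add, add_apply, ← hG.inner_localGrad hx]
  ring

theorem covDeriv_smul (hf : DifferentiableAt ℝ f x) (hX : DifferentiableAt ℝ X x) (u : E) :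
    covDeriv G (fun y => f y • X y) x u = f x • covDeriv G X x u + fderiv ℝ f x u • X x := by
  rw [covDeriv_apply, covDeriv_apply, fderiv_fun_smul hf hX]
  simp only [add_apply, smul_apply, ContinuousLinearMap.smulRight_apply, map_smul, smul_add]
  abel

theorem second_covDeriv_smul (hG : IsLocalMetric U G) (hx : x ∈ U)
    (hf : ∀ y ∈ U, ContDiffAt ℝ ∞ f y) (hX : ∀ y ∈ U, ContDiffAt ℝ ∞ X y) (s u : E) :
    covDerivEnd G (covDeriv G (fun y => f y • X y)) x s u =
      f x • covDerivEnd G (covDeriv G X) x s u + fderiv ℝ f x s • covDeriv G X x u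
        + fderiv ℝ f x u • covDeriv G X x s + hessian G f x s u • X x := by
  have hf1 := diffAt (hf x hx)
  have hf2 := diffAt (contDiffAt_fderiv (hf x hx))
  have hX1 := diffAt (hX x hx)
  have hA := diffAt (hG.contDiffAt_covDeriv hx (hX x hx))
  have hA' : DifferentiableAt ℝ (covDeriv G (fun y => f y • X y)) x :=
    diffAt (hG.contDiffAt_covDeriv hx ((hf x hx).smul (hX x hx)))
  have hAu : DifferentiableAt ℝ (fun y => covDeriv G X y u) x :=
    hA.clm_apply (differentiableAt_const u)
  have hfu : DifferentiableAt ℝ (fun y => fderiv ℝ f y u) x :=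
    hf2.clm_apply (differentiableAt_const u)
  have h := congrArg (fun L : E →L[ℝ] E => L s)
    (fderiv_eq_of_eqOn hG.isOpen hx
      (fun y hy => covDeriv_smul (G := G) (diffAt (hf y hy)) (diffAt (hX y hy)) u))
  rw [fderiv_const_apply hA', fderiv_fun_add (hf1.fun_smul hAu) (hfu.fun_smul hX1), fderiv_fun_smul hf1 hAu,
    fderiv_fun_smul hfu hX1] at h
  simp only [add_apply, smul_apply, ContinuousLinearMap.smulRight_apply, fderiv_const_apply hA,
    fderiv_const_apply hf2] at h
  rw [covDerivEnd, h, covDeriv_smul hf1 hX1, covDeriv_smul hf1 hX1, covDerivEnd,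
    hessian_eq (hf x hx), covDeriv_apply G X x s]
  simp only [← christoffelL_apply, map_add, map_smul, smul_add, smul_sub, sub_smul]
  abel

theorem localConformal_metric (hG : IsLocalMetric U G) (hγ : ∀ y ∈ U, ContDiffAt ℝ ∞ γ y) :
    IsLocalMetric U (localConformal G γ) where
  isOpen := hG.isOpen
  contDiffAt y hy := (contDiffAt_const.mul (hγ y hy)).exp.smul (hG.contDiffAt y hy)
  scalarProduct y hy := (hG.scalarProduct y hy).smul (Real.exp_pos _)

/-- The Christoffel symbols of `e^{2γ} G`. -/
theorem christoffelL_localConformal (hG : IsLocalMetric U G) (hγ : ∀ y ∈ U, ContDiffAt ℝ ∞ γ y)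
    (hx : x ∈ U) (u v : E) :
    christoffelL (localConformal G γ) x u v = christoffelL G x u v + (fderiv ℝ γ x u • v
      + fderiv ℝ γ x v • u - G x u v • localGrad G γ x) := by
  have hG' := hG.localConformal_metric hγ
  have hd (s u v : E) : fderiv ℝ (localConformal G γ) x s u v =
      Real.exp (2 * γ x) * (fderiv ℝ G x s u v + 2 * fderiv ℝ γ x s * G x u v) := by
    have h1 : HasFDerivAt (fun y => Real.exp (2 * γ y))
        (Real.exp (2 * γ x) • ((2 : ℝ) • fderiv ℝ γ x)) x :=
      (((diffAt (hγ x hx)).hasFDerivAt).const_mul 2).exp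
    have h2 := (h1.smul (diffAt (hG.contDiffAt x hx)).hasFDerivAt).fderiv
    have h3 : fderiv ℝ (localConformal G γ) x = _ := h2
    rw [h3]
    simp only [add_apply, smul_apply, ContinuousLinearMap.smulRight_apply, smul_eq_mul]
    ring
  refine (hG'.scalarProduct x hx).ext_left fun w => ?_
  rw [hG'.inner_christoffelL hx]
  simp only [hd, localConformal, smul_apply, map_add, map_sub, add_apply, sub_apply, map_smul,
    smul_eq_mul, hG.inner_christoffelL hx, hG.inner_localGrad hx]
  rw [(hG.scalarProduct x hx).symm u w, (hG.scalarProduct x hx).symm u v,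
    (hG.scalarProduct x hx).symm v w]
  ring

theorem trace_fderiv_smul {F : Type*} [NormedAddCommGroup F] [NormedSpace ℝ F]
    (hG : IsLocalMetric U G) (hx : x ∈ U) (L : E →L[ℝ] F) :
    traceOf G x (fun u v => fderiv ℝ f x u • L v) = L (localGrad G f x) := by
  rw [← traceOf_inner_smul (hG.scalarProduct x hx)]
  exact traceOf_congr fun u v => by rw [hG.inner_localGrad hx]

theorem trace_fderiv_smul' {F : Type*} [NormedAddCommGroup F] [NormedSpace ℝ F]
    (hG : IsLocalMetric U G) (hx : x ∈ U) (L : E →L[ℝ] F) :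
    traceOf G x (fun u v => fderiv ℝ f x v • L u) = L (localGrad G f x) := by
  rw [← hG.trace_fderiv_smul hx L]
  refine traceOf_swap (b := fun u v => fderiv ℝ f x u • L v) (hG.scalarProduct x hx) ?_
  constructor <;> intros <;> simp only [map_add, map_smul, add_smul, smul_add, smul_eq_mul] <;>
    module

/-- The trace of the difference of the connections of `e^{2γ} G` and `G`. -/
theorem trace_conformal_difference (hG : IsLocalMetric U G) (hx : x ∈ U) :
    traceOf G x (fun u v => fderiv ℝ γ x u • v + fderiv ℝ γ x v • u - G x u v • localGrad G γ x) =
      -((Module.finrank ℝ E : ℝ) - 2) • localGrad G γ x := by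
  rw [traceOf_sub, traceOf_add]
  have h1 := hG.trace_fderiv_smul (f := γ) hx (ContinuousLinearMap.id ℝ E)
  have h2 := hG.trace_fderiv_smul' (f := γ) hx (ContinuousLinearMap.id ℝ E)
  have h3 := traceOf_clm (G := G) (x := x)
    ((ContinuousLinearMap.id ℝ ℝ).smulRight (localGrad G γ x)) (fun u v => G x u v)
  simp only [ContinuousLinearMap.coe_id', id_eq, ContinuousLinearMap.smulRight_apply] at h1 h2 h3
  rw [h1, h2, h3, traceOf_inner (hG.scalarProduct x hx)]
  module

end IsLocalMetric

namespace IsLocalKahler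

variable {U : Set E} {G : E → E →L[ℝ] E →L[ℝ] ℝ} {J : E → E →L[ℝ] E} {x : E} {γ : E → ℝ} {a : ℝ}

theorem covDeriv_exp_smul_localGrad (hG : IsLocalMetric U G) (hx : x ∈ U)
    (hγ : ∀ y ∈ U, ContDiffAt ℝ ∞ γ y) (a : ℝ) (u v : E) :
    G x (covDeriv G (fun y => Real.exp (a * γ y) • localGrad G γ y) x u) v =
      Real.exp (a * γ x) * (hessian G γ x u v + a * (fderiv ℝ γ x u * fderiv ℝ γ x v)) := by
  have h1 : HasFDerivAt (fun y => Real.exp (a * γ y)) (Real.exp (a * γ x) • (a • fderiv ℝ γ x)) x :=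
    (((diffAt (hγ x hx)).hasFDerivAt).const_mul a).exp
  rw [IsLocalMetric.covDeriv_smul h1.differentiableAt (diffAt (hG.contDiffAt_localGrad hx (hγ x hx))),
    h1.fderiv]
  simp only [map_add, map_smul, add_apply, smul_apply, hG.inner_covDeriv_localGrad hx hγ,
    hG.inner_localGrad hx, smul_eq_mul]
  ring

/-- If `J(e^{aγ} grad γ)` is a Killing field, then `∇(e^{aγ} grad γ)` commutes with `J`. -/
theorem covDeriv_commute (hJ : IsLocalKahler U G J) (hx : x ∈ U)
    (hγ : ∀ y ∈ U, ContDiffAt ℝ ∞ γ y)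
    (hK : ∀ u v, lieDerivMetric G (fun y => J y (Real.exp (a * γ y) • localGrad G γ y)) x u v = 0)
    (u : E) :
    covDeriv G (fun y => Real.exp (a * γ y) • localGrad G γ y) x (J x u) =
      J x (covDeriv G (fun y => Real.exp (a * γ y) • localGrad G γ y) x u) := by
  have hV : ContDiffAt ℝ ∞ (fun y => Real.exp (a * γ y) • localGrad G γ y) x :=
    (contDiffAt_const.mul (hγ x hx)).exp.smul (hJ.contDiffAt_localGrad hx (hγ x hx))
  -- The covariant derivative of `e^{aγ} grad γ` is dual to `e^{aγ}(∇dγ + a dγ ⊗ dγ)`, hence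
  -- self-adjoint. Combined with the Killing equation, which makes `J` times it skew, this gives the
  -- commutation.
  have hsymm (u v : E) : G x (covDeriv G (fun y => Real.exp (a * γ y) • localGrad G γ y) x u) v =
      G x u (covDeriv G (fun y => Real.exp (a * γ y) • localGrad G γ y) x v) := by
    rw [(hJ.scalarProduct x hx).symm u, covDeriv_exp_smul_localGrad hJ.toIsLocalMetric hx hγ,
      covDeriv_exp_smul_localGrad hJ.toIsLocalMetric hx hγ, hJ.hessian_symm hx (hγ x hx) u v,
      mul_comm (fderiv ℝ γ x u)]
  refine (hJ.scalarProduct x hx).ext_left fun v => ?_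
  have h := hJ.inner_covDeriv_skew hx hK u v
  rw [hJ.covDeriv_complex hx hV, hJ.covDeriv_complex hx hV] at h
  rw [hsymm, hJ.inner_complex_left hx]
  linarith

/-- Since `grad f = -b f grad γ`, the cross term `2∇_{grad f} V` cancels the derivative of `V` in
`2b ∇_{grad γ}(fV)`. What is left is `(Δf - 2b² f |grad γ|²) V`, and the equation for `Δγ` gives `Δf
= 2b² f |grad γ|²`. -/
theorem trace_second_covDeriv_smul (hJ : IsLocalKahler U G J) (hx : x ∈ U)
    (hγ : ∀ y ∈ U, ContDiffAt ℝ ∞ γ y) {V : E → E} (hV : ∀ y ∈ U, ContDiffAt ℝ ∞ V y)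
    (hK : ∀ y ∈ U, ∀ u v, lieDerivMetric G (fun y => J y (V y)) y u v = 0)
    {f : E → ℝ} {b : ℝ} (hf : ∀ y ∈ U, ContDiffAt ℝ ∞ f y)
    (hfγ : ∀ y ∈ U, fderiv ℝ f y = (-b * f y) • fderiv ℝ γ y)
    (hΔ : traceOf G x (hessian G γ x) + b * G x (localGrad G γ x) (localGrad G γ x) = 0) :
    traceOf G x (covDerivEnd G (covDeriv G (fun y => f y • V y)) x)
      + traceOf G x (curvatureOf (christoffelL G) x (f x • V x))
      + (2 * b) • covDeriv G (fun y => f y • V y) x (localGrad G γ x) = 0 := by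
  have hG := hJ.toIsLocalMetric
  have hgradf : localGrad G f x = (-b * f x) • localGrad G γ x := by
    rw [localGrad, hfγ x hx, map_smul, localGrad]
  have hhess (s u : E) : hessian G f x s u =
      f x * (b ^ 2 * (fderiv ℝ γ x s * fderiv ℝ γ x u) - b * hessian G γ x s u) := by
    have h := congrArg (fun L : E →L[ℝ] E →L[ℝ] ℝ => L s u) (fderiv_eq_of_eqOn hG.isOpen hx hfγ)
    have hbf : DifferentiableAt ℝ (fun y => -b * f y) x := (diffAt (hf x hx)).const_mul (-b)
    rw [fderiv_fun_smul hbf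
      (diffAt (contDiffAt_fderiv (hγ x hx))), fderiv_const_mul (diffAt (hf x hx)), hfγ x hx] at h
    simp only [add_apply, smul_apply, ContinuousLinearMap.smulRight_apply, smul_eq_mul] at h
    rw [IsLocalMetric.hessian_eq (hf x hx), IsLocalMetric.hessian_eq (hγ x hx), h, hfγ x hx]
    simp only [smul_apply, smul_eq_mul]
    ring
  have hΔf : traceOf G x (hessian G f x) =
      f x * (b ^ 2 * G x (localGrad G γ x) (localGrad G γ x) - b * traceOf G x (hessian G γ x)) := by
    have h1 := hG.trace_fderiv_smul (f := γ) hx (fderiv ℝ γ x)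
    have h2 := traceOf_congr (G := G) (x := x) hhess
    have h3 := traceOf_smul (G := G) (x := x) (f x)
      (fun s u => b ^ 2 * (fderiv ℝ γ x s * fderiv ℝ γ x u) - b * hessian G γ x s u)
    have h4 := traceOf_smul (G := G) (x := x) (b ^ 2)
      (fun s u => fderiv ℝ γ x s * fderiv ℝ γ x u)
    have h5 := traceOf_smul (G := G) (x := x) b (hessian G γ x)
    simp only [smul_eq_mul] at h1 h3 h4 h5
    rw [h2, h3, traceOf_sub, h4, h5, h1, hG.inner_localGrad hx]
  have hsmul := traceOf_clm (G := G) (x := x)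
    ((ContinuousLinearMap.id ℝ ℝ).smulRight (V x)) (hessian G f x)
  simp only [ContinuousLinearMap.smulRight_apply, ContinuousLinearMap.coe_id', id_eq] at hsmul
  have hcurv : traceOf G x (curvatureOf (christoffelL G) x (f x • V x)) =
      f x • traceOf G x (curvatureOf (christoffelL G) x (V x)) := by
    rw [← traceOf_smul]
    exact traceOf_congr fun u v => by
      simp only [curvatureOf, map_smul, smul_apply, smul_add, smul_sub]
  rw [traceOf_congr (hG.second_covDeriv_smul hx hf hV), traceOf_add, traceOf_add, traceOf_add,
    hsmul, hΔf, hG.trace_fderiv_smul hx, hG.trace_fderiv_smul' hx, traceOf_smul, hcurv,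
    hJ.trace_second_covDeriv hV hK hx,
    IsLocalMetric.covDeriv_smul (diffAt (hf x hx)) (diffAt (hV x hx)), hgradf, hfγ x hx]
  -- The hypothesis on `Δγ` is needed only after multiplication by `b`, the form in which it occurs
  -- in `Δf`.
  have hb : b * traceOf G x (hessian G γ x) =
      -(b ^ 2 * G x (localGrad G γ x) (localGrad G γ x)) := by linear_combination b * hΔ
  rw [hb, smul_apply, ← hG.inner_localGrad hx, map_smul]
  module

end IsLocalKahler

end Gradient

/-! ### The (1,2)-symplectic condition in terms of `∇J` -/

section OneTwoSymplectic

variable {E : Type*} [NormedAddCommGroup E] [NormedSpace ℝ E] [FiniteDimensional ℝ E]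

namespace IsLocalHermitian

variable {U : Set E} {G : E → E →L[ℝ] E →L[ℝ] ℝ} {J : E → E →L[ℝ] E} {x : E}

/-- The derivative of `J² = -1`: `∇_s J` anticommutes with `J`. -/
theorem covDerivEnd_complex (hJ : IsLocalHermitian U G J) (hx : x ∈ U) (s u : E) :
    covDerivEnd G J x s (J x u) = -J x (covDerivEnd G J x s u) := by
  have hd := diffAt (hJ.contDiffAt_complex x hx)
  have h := congrArg (fun L : E →L[ℝ] E => L s)
    (fderiv_eq_of_eqOn hJ.isOpen hx (fun y hy => hJ.sq_neg y hy u))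
  rw [fderiv_apply_field hd (hd.clm_apply (differentiableAt_const u)), fderiv_const_apply hd,
    fderiv_fun_const, Pi.zero_apply, zero_apply] at h
  simp only [covDerivEnd, ← christoffelL_apply, map_add, map_sub, hJ.sq_neg x hx, map_neg]
  rw [eq_neg_of_add_eq_zero_left h]
  abel

/-- As the connection is metric and torsion-free, the Christoffel terms cancel and `dΩ` is the
cyclic sum of `∇Ω`. -/
theorem dFundamentalForm_eq (hJ : IsLocalHermitian U G J) (hx : x ∈ U) (u v w : E) :
    dFundamentalForm G J x u v w = G x v (covDerivEnd G J x u w) + G x w (covDerivEnd G J x v u)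
      + G x u (covDerivEnd G J x w v) := by
  have hG := diffAt (hJ.contDiffAt x hx)
  have hd := diffAt (hJ.contDiffAt_complex x hx)
  have h (s a b : E) : fderiv ℝ (fun y => G y a (J y b)) x s = G x (christoffelL G x s a) (J x b)
      + G x a (covDerivEnd G J x s b) - G x (J x a) (christoffelL G x s b) := by
    rw [fderiv_apply_field₂ hG (differentiableAt_const a) (hd.clm_apply (differentiableAt_const b)),
      fderiv_const_apply hd, hJ.fderiv_eq hx, hJ.inner_complex_left hx]
    simp only [covDerivEnd, ← christoffelL_apply, map_add, map_sub, fderiv_fun_const,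
      Pi.zero_apply, zero_apply, map_zero]
    ring
  rw [dFundamentalForm, h, h, h, hJ.christoffelL_symm hx v u, hJ.christoffelL_symm hx w u,
    hJ.christoffelL_symm hx w v, (hJ.scalarProduct x hx).symm (J x u),
    (hJ.scalarProduct x hx).symm (J x v), (hJ.scalarProduct x hx).symm (J x w)]
  ring

/-- In a (1,2)-symplectic manifold `(∇_{Ju} J) v = -J (∇_u J) v`. -/
theorem covDerivEnd_of_oneTwoSymplectic (hJ : IsLocalHermitian U G J) (hx : x ∈ U)
    (h12 : ∀ u v w : E, complexExtension (dFundamentalForm G J x) (u, -J x u) (v, J x v)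
      (w, J x w) = 0) (u v : E) :
    covDerivEnd G J x (J x u) v = -J x (covDerivEnd G J x u v) := by
  have hS := hJ.scalarProduct x hx
  have hc := isBilinearMap_covDerivEnd G J x
  set q : E → E → E → ℝ := fun a b c => G x (covDerivEnd G J x a b) c with hq
  have hα (a b c : E) : dFundamentalForm G J x a b c = q a c b + q b a c + q c b a := by
    rw [hJ.dFundamentalForm_eq hx, hS.symm b, hS.symm c, hS.symm a]
  have hq1 (a b c : E) : q (-a) b c = -q a b c := by
    have h : covDerivEnd G J x (-a) b = -covDerivEnd G J x a b := hc.toLinearMap.map_neg₂ a b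
    simp only [hq, h, map_neg, neg_apply]
  have hq2 (a b c : E) : q a (-b) c = -q a b c := by
    have h : covDerivEnd G J x a (-b) = -covDerivEnd G J x a b := (hc.toLinearMap a).map_neg b
    simp only [hq, h, map_neg, neg_apply]
  have hq3 (a b c : E) : q a b (-c) = -q a b c := by simp only [hq, map_neg]
  have hqJ (a b c : E) : q a (J x b) c = q a b (J x c) := by
    simp only [hq, hJ.covDerivEnd_complex hx, map_neg, neg_apply, hJ.inner_complex_left hx, neg_neg]
  refine hS.ext_left fun w => ?_
  -- With `-Jw` and `v` in the last two slots, the derivatives of `J` in the directions `v`, `Jv`,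
  -- `w`, `Jw` cancel. Twice the desired identity, paired with `w`, remains.
  have h := congrArg Complex.re (h12 u (-J x w) v)
  simp only [complexExtension, Complex.zero_re, hα, map_neg, hJ.sq_neg x hx, hq1, hq2, hq3, hqJ,
    neg_neg] at h
  rw [map_neg, neg_apply, hJ.inner_complex_left hx]
  simp only [hq] at h
  linarith

end IsLocalHermitian

end OneTwoSymplectic

/-! ### Second fundamental form of a map and the Codazzi equation -/

section Maps

variable {E F : Type*} [NormedAddCommGroup E] [NormedSpace ℝ E] [FiniteDimensional ℝ E]
  [NormedAddCommGroup F] [NormedSpace ℝ F] [FiniteDimensional ℝ F]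

/-- Smooth maps between open sets. -/
structure IsLocalMap (U : Set E) (U' : Set F) (φ : E → F) : Prop where
  contDiffAt (x : E) (hx : x ∈ U) : ContDiffAt ℝ ∞ φ x
  mapsTo (x : E) (hx : x ∈ U) : φ x ∈ U'

/-- The second fundamental form as a bilinear map. -/
def secondFormL (G : E → E →L[ℝ] E →L[ℝ] ℝ) (H : F → F →L[ℝ] F →L[ℝ] ℝ) (φ : E → F) (x : E) :
    E →L[ℝ] E →L[ℝ] F :=
  fderiv ℝ (fderiv ℝ φ) x
    + ((christoffelL H (φ x) ∘L fderiv ℝ φ x).flip ∘L fderiv ℝ φ x).flip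
    - (ContinuousLinearMap.compL ℝ E E F (fderiv ℝ φ x)) ∘L christoffelL G x

theorem secondFormL_apply (G : E → E →L[ℝ] E →L[ℝ] ℝ) (H : F → F →L[ℝ] F →L[ℝ] ℝ) (φ : E → F)
    (x u v : E) : secondFormL G H φ x u v = fderiv ℝ (fderiv ℝ φ) x u v
      + christoffelL H (φ x) (fderiv ℝ φ x u) (fderiv ℝ φ x v)
      - fderiv ℝ φ x (christoffelL G x u v) := rfl

/-- The covariant derivative `(∇_s ∇dφ)(u, v)` of the second fundamental form. -/
def covDerivSecondForm (G : E → E →L[ℝ] E →L[ℝ] ℝ) (H : F → F →L[ℝ] F →L[ℝ] ℝ) (φ : E → F)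
    (x s u v : E) : F :=
  fderiv ℝ (secondFormL G H φ) x s u v
    + christoffelL H (φ x) (fderiv ℝ φ x s) (secondFormL G H φ x u v)
    - secondFormL G H φ x (christoffelL G x s u) v - secondFormL G H φ x u (christoffelL G x s v)

variable {U : Set E} {U' : Set F} {G : E → E →L[ℝ] E →L[ℝ] ℝ} {H : F → F →L[ℝ] F →L[ℝ] ℝ}
  {φ : E → F} {x : E} {X : E → E}

namespace IsLocalMap

theorem secondFundamentalForm_eq (hφ : IsLocalMap U U' φ) (hx : x ∈ U) (u v : E) :
    secondFundamentalForm G H φ x u v = secondFormL G H φ x u v := by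
  rw [secondFundamentalForm, covAlong,
    fderiv_const_apply (diffAt (contDiffAt_fderiv (hφ.contDiffAt x hx)))]
  rfl

theorem contDiffAt_christoffel_comp (hφ : IsLocalMap U U' φ) (hH : IsLocalMetric U' H)
    (hx : x ∈ U) : ContDiffAt ℝ ∞ (fun y => christoffelL H (φ y)) x :=
  (hH.contDiffAt_christoffelL (hφ.mapsTo x hx)).comp x (hφ.contDiffAt x hx)

theorem fderiv_christoffel_comp (hφ : IsLocalMap U U' φ) (hH : IsLocalMetric U' H)
    (hx : x ∈ U) (s : E) : fderiv ℝ (fun y => christoffelL H (φ y)) x s =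
      fderiv ℝ (christoffelL H) (φ x) (fderiv ℝ φ x s) := by
  have h := fderiv_comp x (diffAt (hH.contDiffAt_christoffelL (hφ.mapsTo x hx)))
    (diffAt (hφ.contDiffAt x hx))
  exact congrArg (fun L : E →L[ℝ] F →L[ℝ] F →L[ℝ] F => L s) h

theorem contDiffAt_secondFormL (hφ : IsLocalMap U U' φ) (hG : IsLocalMetric U G)
    (hH : IsLocalMetric U' H) (hx : x ∈ U) : ContDiffAt ℝ ∞ (secondFormL G H φ) x := by
  have h1 := contDiffAt_fderiv (hφ.contDiffAt x hx)
  have h2 := (hφ.contDiffAt_christoffel_comp hH hx).clm_comp h1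
  have h3 := ((ContinuousLinearMap.flipₗᵢ ℝ E F F).contDiff.contDiffAt.comp x h2).clm_comp h1
  exact ((contDiffAt_fderiv h1).add
    ((ContinuousLinearMap.flipₗᵢ ℝ E E F).contDiff.contDiffAt.comp x h3)).sub
    (((ContinuousLinearMap.compL ℝ E E F).contDiff.contDiffAt.comp x h1).clm_comp
      (hG.contDiffAt_christoffelL hx))

theorem secondFormL_symm (hφ : IsLocalMap U U' φ) (hG : IsLocalMetric U G)
    (hH : IsLocalMetric U' H) (hx : x ∈ U) (u v : E) :
    secondFormL G H φ x u v = secondFormL G H φ x v u := by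
  rw [secondFormL_apply, secondFormL_apply, fderiv_fderiv_symm (hφ.contDiffAt x hx),
    hG.christoffelL_symm hx, hH.christoffelL_symm (hφ.mapsTo x hx)]

theorem fderiv_secondFormL (hφ : IsLocalMap U U' φ) (hG : IsLocalMetric U G)
    (hH : IsLocalMetric U' H) (hx : x ∈ U) (s u v : E) :
    fderiv ℝ (secondFormL G H φ) x s u v = fderiv ℝ (fderiv ℝ (fderiv ℝ φ)) x s u v
      + fderiv ℝ (christoffelL H) (φ x) (fderiv ℝ φ x s) (fderiv ℝ φ x u) (fderiv ℝ φ x v)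
      + christoffelL H (φ x) (fderiv ℝ (fderiv ℝ φ) x s u) (fderiv ℝ φ x v)
      + christoffelL H (φ x) (fderiv ℝ φ x u) (fderiv ℝ (fderiv ℝ φ) x s v)
      - fderiv ℝ (fderiv ℝ φ) x s (christoffelL G x u v)
      - fderiv ℝ φ x (fderiv ℝ (christoffelL G) x s u v) := by
  have h1 := contDiffAt_fderiv (hφ.contDiffAt x hx)
  have d1 := diffAt h1
  have d2 := diffAt (contDiffAt_fderiv h1)
  have dK := diffAt (hφ.contDiffAt_christoffel_comp hH hx)
  have dΓ := diffAt (hG.contDiffAt_christoffelL hx)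
  have dB := diffAt (hφ.contDiffAt_secondFormL hG hH hx)
  have d1' (w : E) : DifferentiableAt ℝ (fun y => fderiv ℝ φ y w) x :=
    d1.clm_apply (differentiableAt_const w)
  have d2u : DifferentiableAt ℝ (fun y => fderiv ℝ (fderiv ℝ φ) y u) x :=
    d2.clm_apply (differentiableAt_const u)
  have dΓu : DifferentiableAt ℝ (fun y => christoffelL G y u) x :=
    dΓ.clm_apply (differentiableAt_const u)
  have dΓuv : DifferentiableAt ℝ (fun y => christoffelL G y u v) x :=
    dΓu.clm_apply (differentiableAt_const v)
  have dBu : DifferentiableAt ℝ (fun y => secondFormL G H φ y u) x :=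
    dB.clm_apply (differentiableAt_const u)
  have e1 : DifferentiableAt ℝ (fun y => fderiv ℝ (fderiv ℝ φ) y u v) x :=
    d2u.clm_apply (differentiableAt_const v)
  have e2 : DifferentiableAt ℝ
      (fun y => christoffelL H (φ y) (fderiv ℝ φ y u) (fderiv ℝ φ y v)) x :=
    (dK.clm_apply (d1' u)).clm_apply (d1' v)
  have e3 : DifferentiableAt ℝ (fun y => fderiv ℝ φ y (christoffelL G y u v)) x :=
    d1.clm_apply dΓuv
  rw [← fderiv_const_apply dB, ← fderiv_const_apply dBu]
  simp only [secondFormL_apply]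
  rw [fderiv_fun_sub (e1.fun_add e2) e3, fderiv_fun_add e1 e2, sub_apply, add_apply,
    fderiv_const_apply d2u, fderiv_const_apply d2, fderiv_apply_field₂ dK (d1' u) (d1' v),
    fderiv_apply_field d1 dΓuv, fderiv_const_apply d1, fderiv_const_apply d1,
    fderiv_const_apply dΓu, fderiv_const_apply dΓ, hφ.fderiv_christoffel_comp hH hx]
  abel

theorem covDerivSecondForm_symm (hφ : IsLocalMap U U' φ) (hG : IsLocalMetric U G)
    (hH : IsLocalMetric U' H) (hx : x ∈ U) (s u v : E) :
    covDerivSecondForm G H φ x s u v = covDerivSecondForm G H φ x s v u := by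
  have dB := diffAt (hφ.contDiffAt_secondFormL hG hH hx)
  have dB' (w : E) : DifferentiableAt ℝ (fun y => secondFormL G H φ y w) x :=
    dB.clm_apply (differentiableAt_const w)
  have h := congrArg (fun L : E →L[ℝ] F => L s)
    (fderiv_eq_of_eqOn hG.isOpen hx (fun y hy => hφ.secondFormL_symm hG hH hy u v))
  rw [fderiv_const_apply (dB' u), fderiv_const_apply (dB' v), fderiv_const_apply dB,
    fderiv_const_apply dB] at h
  rw [covDerivSecondForm, covDerivSecondForm, h, hφ.secondFormL_symm hG hH hx u v,
    hφ.secondFormL_symm hG hH hx _ v, hφ.secondFormL_symm hG hH hx u]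
  abel

/-- The Codazzi equation of a map. -/
theorem codazzi (hφ : IsLocalMap U U' φ) (hG : IsLocalMetric U G)
    (hH : IsLocalMetric U' H) (hx : x ∈ U) (s u v : E) :
    covDerivSecondForm G H φ x s u v - covDerivSecondForm G H φ x u s v =
      curvatureOf (christoffelL H) (φ x) (fderiv ℝ φ x s) (fderiv ℝ φ x u) (fderiv ℝ φ x v)
        - fderiv ℝ φ x (curvatureOf (christoffelL G) x s u v) := by
  simp only [covDerivSecondForm, hφ.fderiv_secondFormL hG hH hx, secondFormL_apply, curvatureOf,
    map_add, map_sub]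
  rw [fderiv_fderiv_symm (contDiffAt_fderiv (hφ.contDiffAt x hx)) u s,
    fderiv_fderiv_symm (hφ.contDiffAt x hx) u s, hG.christoffelL_symm hx u s]
  abel

theorem covAlong_fderiv (hφ : IsLocalMap U U' φ) (hx : x ∈ U) (hX : DifferentiableAt ℝ X x)
    (v : E) : covAlong H φ (fun y => fderiv ℝ φ y (X y)) x v =
      secondFormL G H φ x v (X x) + fderiv ℝ φ x (covDeriv G X x v) := by
  rw [covAlong, fderiv_apply_field (diffAt (contDiffAt_fderiv (hφ.contDiffAt x hx))) hX,
    secondFormL_apply, covDeriv_apply, map_add, ← christoffelL_apply]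
  abel

/-- The Leibniz rule for `∇²(dφ X)`. It is needed because the tension field for the conformal metric
has the form `dφ(X)`. -/
theorem secondCovAlong_fderiv (hφ : IsLocalMap U U' φ) (hG : IsLocalMetric U G)
    (hH : IsLocalMetric U' H) (hX : ∀ y ∈ U, ContDiffAt ℝ ∞ X y) (hx : x ∈ U) (u v : E) :
    secondCovAlong G H φ (fun y => fderiv ℝ φ y (X y)) x u v =
      covDerivSecondForm G H φ x u v (X x) + secondFormL G H φ x v (covDeriv G X x u)
        + secondFormL G H φ x u (covDeriv G X x v)
        + fderiv ℝ φ x (covDerivEnd G (covDeriv G X) x u v) := by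
  have dX := diffAt (hX x hx)
  have d1 := diffAt (contDiffAt_fderiv (hφ.contDiffAt x hx))
  have dB := diffAt (hφ.contDiffAt_secondFormL hG hH hx)
  have dBv : DifferentiableAt ℝ (fun y => secondFormL G H φ y v) x :=
    dB.clm_apply (differentiableAt_const v)
  have dA := diffAt (hG.contDiffAt_covDeriv hx (hX x hx))
  have dAv : DifferentiableAt ℝ (fun y => covDeriv G X y v) x :=
    dA.clm_apply (differentiableAt_const v)
  have h := congrArg (fun L : E →L[ℝ] F => L u) (fderiv_eq_of_eqOn hG.isOpen hx
    (fun y hy => hφ.covAlong_fderiv (G := G) (H := H) hy (diffAt (hX y hy)) v))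
  rw [fderiv_fun_add (dBv.clm_apply dX) (d1.clm_apply dAv), add_apply, fderiv_apply_field dBv dX,
    fderiv_apply_field d1 dAv, fderiv_const_apply dB, fderiv_const_apply dA] at h
  rw [secondCovAlong, covAlong, h, hφ.covAlong_fderiv (G := G) hx dX,
    hφ.covAlong_fderiv (G := G) hx dX, covDerivSecondForm, covDeriv_apply G X x u, covDerivEnd,
    secondFormL_apply G H φ x u (covDeriv G X x v)]
  simp only [← christoffelL_apply, map_add, map_sub]
  abel

end IsLocalMap

end Maps

/-! ### Holomorphic maps and the local bitension field -/

section Holomorphic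

variable {E F : Type*} [NormedAddCommGroup E] [NormedSpace ℝ E] [FiniteDimensional ℝ E]
  [NormedAddCommGroup F] [NormedSpace ℝ F] [FiniteDimensional ℝ F]

/-- Holomorphic maps from a Kähler structure to a (1,2)-symplectic structure on open sets. -/
structure IsLocalHolomorphic (U : Set E) (U' : Set F) (G : E → E →L[ℝ] E →L[ℝ] ℝ)
    (H : F → F →L[ℝ] F →L[ℝ] ℝ) (J : E → E →L[ℝ] E) (J' : F → F →L[ℝ] F) (φ : E → F) : Prop
    extends IsLocalMap U U' φ where
  kahler : IsLocalKahler U G J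
  hermitian : IsLocalHermitian U' H J'
  oneTwoSymplectic (y : F) (hy : y ∈ U') (u v w : F) :
    complexExtension (dFundamentalForm H J' y) (u, -J' y u) (v, J' y v) (w, J' y w) = 0
  fderiv_complex (x : E) (hx : x ∈ U) (v : E) : fderiv ℝ φ x (J x v) = J' (φ x) (fderiv ℝ φ x v)

variable {U : Set E} {U' : Set F} {G : E → E →L[ℝ] E →L[ℝ] ℝ} {H : F → F →L[ℝ] F →L[ℝ] ℝ}
  {J : E → E →L[ℝ] E} {J' : F → F →L[ℝ] F} {φ : E → F} {x : E} {X : E → E}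

theorem isBilinearMap_covDerivSecondForm (w : E) :
    IsBilinearMap ℝ (fun u v => covDerivSecondForm G H φ x u v w) := by
  constructor <;> intros <;> simp only [covDerivSecondForm, map_add, map_smul, add_apply,
    smul_apply] <;> module

theorem isBilinearMap_covDerivSecondForm' (w : E) :
    IsBilinearMap ℝ (covDerivSecondForm G H φ x w) := by
  constructor <;> intros <;> simp only [covDerivSecondForm, map_add, map_smul, add_apply,
    smul_apply] <;> module

theorem covAlong_congr (hU : IsOpen U) (hx : x ∈ U) {V W : E → F} (h : ∀ y ∈ U, V y = W y) (u : E) :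
    covAlong H φ V x u = covAlong H φ W x u := by
  rw [covAlong, covAlong, fderiv_eq_of_eqOn hU hx h, h x hx]

namespace IsLocalHolomorphic

/-- The derivative of `dφ ∘ J = J' ∘ dφ`. The source contributes no `∇J` term since it is Kähler. -/
theorem secondFormL_complex_right (hφ : IsLocalHolomorphic U U' G H J J' φ) (hx : x ∈ U) (u v : E) :
    secondFormL G H φ x u (J x v) =
      covDerivEnd H J' (φ x) (fderiv ℝ φ x u) (fderiv ℝ φ x v)
        + J' (φ x) (secondFormL G H φ x u v) := by
  have dJ := diffAt (hφ.kahler.contDiffAt_complex x hx)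
  have dJ' := diffAt (hφ.hermitian.contDiffAt_complex (φ x) (hφ.mapsTo x hx))
  have dφ := diffAt (hφ.contDiffAt x hx)
  have d1 := diffAt (contDiffAt_fderiv (hφ.contDiffAt x hx))
  have h := congrArg (fun L : E →L[ℝ] F => L u)
    (fderiv_eq_of_eqOn hφ.kahler.isOpen hx (fun y hy => hφ.fderiv_complex y hy v))
  have hcomp : fderiv ℝ (fun y => J' (φ y)) x u = fderiv ℝ J' (φ x) (fderiv ℝ φ x u) :=
    congrArg (fun L : E →L[ℝ] F →L[ℝ] F => L u) (fderiv_comp x dJ' dφ)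
  rw [fderiv_apply_field d1 (dJ.clm_apply (differentiableAt_const v)), fderiv_const_apply dJ,
    fderiv_apply_field (A := fun y => J' (φ y)) (dJ'.comp x dφ)
      (d1.clm_apply (differentiableAt_const v)), fderiv_const_apply d1, hcomp,
    hφ.kahler.fderiv_complex hx, map_sub, hφ.fderiv_complex x hx] at h
  rw [secondFormL_apply, secondFormL_apply, covDerivEnd, hφ.fderiv_complex x hx]
  simp only [← christoffelL_apply, map_add, map_sub]
  rw [← sub_eq_zero] at h ⊢
  rw [← h]
  abel

/-- Moving `J` out of both slots and using the (1,2)-symplectic identity, `B(Ju,Jv) + B(u,v)`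
becomes an expression antisymmetric in `u` and `v`. It is also symmetric, so it vanishes. -/
theorem secondFormL_complex (hφ : IsLocalHolomorphic U U' G H J J' φ) (hx : x ∈ U) (u v : E) :
    secondFormL G H φ x (J x u) (J x v) = -secondFormL G H φ x u v := by
  have hy := hφ.mapsTo x hx
  have sy := hφ.secondFormL_symm hφ.kahler.toIsLocalMetric hφ.hermitian.toIsLocalMetric hx
  have key (u v : E) : secondFormL G H φ x (J x u) (J x v) + secondFormL G H φ x u v =
      J' (φ x) (covDerivEnd H J' (φ x) (fderiv ℝ φ x v) (fderiv ℝ φ x u))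
        - J' (φ x) (covDerivEnd H J' (φ x) (fderiv ℝ φ x u) (fderiv ℝ φ x v)) := by
    rw [hφ.secondFormL_complex_right hx, sy _ v, hφ.secondFormL_complex_right hx,
      hφ.fderiv_complex x hx, hφ.hermitian.covDerivEnd_of_oneTwoSymplectic hy
        (hφ.oneTwoSymplectic _ hy), map_add, hφ.hermitian.sq_neg _ hy, sy v u]
    abel
  have h := key u v
  have h' := key v u
  rw [sy (J x v), sy v u, h] at h'
  have h2 : (2 : ℝ) • (secondFormL G H φ x (J x u) (J x v) + secondFormL G H φ x u v) = 0 := by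
    rw [two_smul]
    nth_rewrite 2 [h]
    rw [h', h]
    abel
  exact eq_neg_of_add_eq_zero_left ((smul_eq_zero.1 h2).resolve_left two_ne_zero)

/-- The antisymmetry of `B` under `J` passes to `∇_s B` because `J` is parallel. -/
theorem covDerivSecondForm_complex (hφ : IsLocalHolomorphic U U' G H J J' φ) (hx : x ∈ U)
    (s u v : E) :
    covDerivSecondForm G H φ x s (J x u) (J x v) = -covDerivSecondForm G H φ x s u v := by
  have dJ := diffAt (hφ.kahler.contDiffAt_complex x hx)
  have dJ1 (w : E) : DifferentiableAt ℝ (fun y => J y w) x := dJ.clm_apply (differentiableAt_const w)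
  have dB := diffAt (hφ.contDiffAt_secondFormL hφ.kahler.toIsLocalMetric
    hφ.hermitian.toIsLocalMetric hx)
  have dBu : DifferentiableAt ℝ (fun y => secondFormL G H φ y u) x :=
    dB.clm_apply (differentiableAt_const u)
  have h := congrArg (fun L : E →L[ℝ] F => L s)
    (fderiv_eq_of_eqOn hφ.kahler.isOpen hx (fun y hy => hφ.secondFormL_complex hy u v))
  rw [fderiv_apply_field₂ dB (dJ1 u) (dJ1 v), fderiv_fun_neg, neg_apply, fderiv_const_apply dBu,
    fderiv_const_apply dB, fderiv_const_apply dJ, fderiv_const_apply dJ,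
    hφ.kahler.fderiv_complex hx, hφ.kahler.fderiv_complex hx] at h
  simp only [map_sub, sub_apply, hφ.secondFormL_complex hx] at h
  simp only [covDerivSecondForm, hφ.secondFormL_complex hx, map_neg]
  rw [← sub_eq_zero] at h ⊢
  rw [← h]
  abel

theorem trace_secondFormL (hφ : IsLocalHolomorphic U U' G H J J' φ) (hx : x ∈ U) :
    traceOf G x (fun u v => secondFormL G H φ x u v) = 0 :=
  traceOf_eq_zero_of_isometry (hφ.kahler.scalarProduct x hx) _ (J x) (hφ.kahler.sq_neg x hx)
    (hφ.kahler.isometry x hx) (hφ.secondFormL_complex hx)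

/-- Codazzi exchanges `(∇_u B)(w, v)` for `(∇_w B)(u, v)`, whose trace over `u, v` is zero by
`J`-antisymmetry. Only the two curvature terms remain. -/
theorem trace_covDerivSecondForm (hφ : IsLocalHolomorphic U U' G H J J' φ) (hx : x ∈ U) (w : E) :
    traceOf G x (fun u v => covDerivSecondForm G H φ x u v w) =
      -traceOf G x (fun u v => curvatureOf (christoffelL H) (φ x) (fderiv ℝ φ x w) (fderiv ℝ φ x u)
        (fderiv ℝ φ x v)) + fderiv ℝ φ x (traceOf G x (curvatureOf (christoffelL G) x w)) := by
  have hG := hφ.kahler.toIsLocalMetric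
  have hH := hφ.hermitian.toIsLocalMetric
  have h0 : traceOf G x (covDerivSecondForm G H φ x w) = 0 :=
    traceOf_eq_zero (hG.scalarProduct x hx) (isBilinearMap_covDerivSecondForm' w) (J x)
      (hφ.kahler.sq_neg x hx) (hφ.kahler.isometry x hx) (hφ.covDerivSecondForm_complex hx w)
  rw [← traceOf_clm (fderiv ℝ φ x), ← zero_add (-traceOf G x _), ← h0, ← traceOf_neg, ← traceOf_add,
    ← traceOf_add]
  refine traceOf_congr fun u v => ?_
  rw [hφ.covDerivSecondForm_symm hG hH hx u v w,
    sub_eq_iff_eq_add.1 (hφ.codazzi hG hH hx u w v),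
    IsLocalMetric.curvature_antisymm _ _ (fderiv ℝ φ x u),
    IsLocalMetric.curvature_antisymm _ _ u, map_neg]
  abel

/-- The tension field with respect to `e^{2γ} G`. -/
theorem tension_localConformal (hφ : IsLocalHolomorphic U U' G H J J' φ) {γ : E → ℝ}
    (hγ : ∀ y ∈ U, ContDiffAt ℝ ∞ γ y) (hx : x ∈ U) :
    tension (localConformal G γ) H φ x = fderiv ℝ φ x
      ((((Module.finrank ℝ E : ℝ) - 2) * Real.exp (-2 * γ x)) • localGrad G γ x) := by
  have hG := hφ.kahler.toIsLocalMetric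
  -- The domain metric enters `∇dφ` only through its connection, so the conformal change subtracts
  -- `dφ` of the difference tensor.
  have h1 (u v : E) : secondFundamentalForm (localConformal G γ) H φ x u v =
      secondFormL G H φ x u v - fderiv ℝ φ x (fderiv ℝ γ x u • v
      + fderiv ℝ γ x v • u - G x u v • localGrad G γ x) := by
    rw [hφ.secondFundamentalForm_eq hx, secondFormL_apply, secondFormL_apply,
      hG.christoffelL_localConformal hγ hx, map_add]
    abel
  have hb : IsBilinearMap ℝ (fun u v => secondFormL G H φ x u v - fderiv ℝ φ x (fderiv ℝ γ x u • v
      + fderiv ℝ γ x v • u - G x u v • localGrad G γ x)) := by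
    constructor <;> intros <;> simp only [map_add, map_sub, map_smul, add_apply, smul_apply,
      smul_eq_mul] <;> module
  rw [tension, traceOf_congr h1,
    traceOf_conformal (hG.scalarProduct x hx) (Real.exp_pos _) rfl hb, traceOf_sub,
    hφ.trace_secondFormL hx, traceOf_clm (fderiv ℝ φ x), hG.trace_conformal_difference hx,
    ← Real.exp_neg, neg_mul]
  simp only [map_smul]
  module

theorem bitension_localConformal (hφ : IsLocalHolomorphic U U' G H J J' φ) {γ : E → ℝ}
    (hγ : ∀ y ∈ U, ContDiffAt ℝ ∞ γ y)
    (hK : ∀ y ∈ U, ∀ u v, lieDerivMetric G (fun y =>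
      J y (Real.exp (((Module.finrank ℝ E : ℝ) - 6) / 2 * γ y) • localGrad G γ y)) y u v = 0)
    (hx : x ∈ U)
    (hΔ : traceOf G x (hessian G γ x) + ((Module.finrank ℝ E : ℝ) - 2) / 2 *
      G x (localGrad G γ x) (localGrad G γ x) = 0) :
    bitension (localConformal G γ) H φ x = 0 := by
  have hG := hφ.kahler.toIsLocalMetric
  have hH := hφ.hermitian.toIsLocalMetric
  set m : ℝ := (Module.finrank ℝ E : ℝ) with hm
  set V : E → E := fun y => Real.exp ((m - 6) / 2 * γ y) • localGrad G γ y with hVdef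
  -- The exponents `(m-6)/2` and `-(m-2)/2` add to `-2`, so `f V` is the field whose image under
  -- `dφ` is the tension field.
  set f : E → ℝ := fun y => (m - 2) * Real.exp (-((m - 2) / 2) * γ y) with hfdef
  set X : E → E := fun y => f y • V y with hXdef
  have hV : ∀ y ∈ U, ContDiffAt ℝ ∞ V y := fun y hy =>
    (contDiffAt_const.mul (hγ y hy)).exp.smul (hG.contDiffAt_localGrad hy (hγ y hy))
  have hf : ∀ y ∈ U, ContDiffAt ℝ ∞ f y := fun y hy =>
    contDiffAt_const.mul (contDiffAt_const.mul (hγ y hy)).exp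
  have hX : ∀ y ∈ U, ContDiffAt ℝ ∞ X y := fun y hy => (hf y hy).smul (hV y hy)
  have hfγ : ∀ y ∈ U, fderiv ℝ f y = (-((m - 2) / 2) * f y) • fderiv ℝ γ y := fun y hy => by
    have h1 : HasFDerivAt f _ y :=
      ((((diffAt (hγ y hy)).hasFDerivAt).const_mul (-((m - 2) / 2))).exp).const_mul (m - 2)
    rw [h1.fderiv]
    simp only [hfdef]
    module
  have htension : ∀ y ∈ U, tension (localConformal G γ) H φ y = fderiv ℝ φ y (X y) := fun y hy => by
    rw [hφ.tension_localConformal hγ hy]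
    simp only [hXdef, hfdef, hVdef, smul_smul, mul_assoc, ← Real.exp_add, ← hm]
    congr 4
    ring
  -- `L v` is the derivative of `dφ(X)` along `v`; by linearity the connection change enters the
  -- second derivative through `L` of the difference tensor.
  set L : E →L[ℝ] F := (secondFormL G H φ x).flip (X x) + fderiv ℝ φ x ∘L covDeriv G X x with hL
  have hLapply (v : E) : covAlong H φ (fun y => fderiv ℝ φ y (X y)) x v = L v :=
    hφ.covAlong_fderiv hx (diffAt (hX x hx)) v
  have hsecond (u v : E) :
      secondCovAlong (localConformal G γ) H φ (tension (localConformal G γ) H φ) x u v =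
      covDerivSecondForm G H φ x u v (X x) + secondFormL G H φ x v (covDeriv G X x u)
        + secondFormL G H φ x u (covDeriv G X x v)
        + fderiv ℝ φ x (covDerivEnd G (covDeriv G X) x u v)
        - L (fderiv ℝ γ x u • v + fderiv ℝ γ x v • u - G x u v • localGrad G γ x) := by
    have hcov : ∀ y ∈ U, ∀ w, covAlong H φ (tension (localConformal G γ) H φ) y w =
        covAlong H φ (fun y => fderiv ℝ φ y (X y)) y w := fun y hy w =>
      covAlong_congr hG.isOpen hy htension w
    rw [← hφ.secondCovAlong_fderiv hG hH hX hx, secondCovAlong, secondCovAlong,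
      covAlong_congr hG.isOpen hx (fun y hy => hcov y hy v), hcov x hx, hLapply, hLapply,
      ← christoffelL_apply, hG.christoffelL_localConformal hγ hx, map_add L, ← christoffelL_apply]
    abel
  have hcurv (u v : E) : curvature H (φ x) (tension (localConformal G γ) H φ x) (fderiv ℝ φ x u)
      (fderiv ℝ φ x v) = curvatureOf (christoffelL H) (φ x) (fderiv ℝ φ x (X x)) (fderiv ℝ φ x u)
        (fderiv ℝ φ x v) := by
    rw [hH.curvature_eq (hφ.mapsTo x hx), htension x hx]
  have hcovX (v : E) : covDeriv G X x v =
      f x • covDeriv G V x v + (-((m - 2) / 2)) • fderiv ℝ γ x v • X x := by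
    rw [hXdef, IsLocalMetric.covDeriv_smul (diffAt (hf x hx)) (diffAt (hV x hx)), hfγ x hx]
    simp only [smul_apply, smul_eq_mul]
    module
  -- `∇V` commutes with `J`, so `B(u, ∇_v V)` inherits the antisymmetry of `B` under `J`.
  have hBA : traceOf G x (fun u v => secondFormL G H φ x u (covDeriv G V x v)) = 0 := by
    refine traceOf_eq_zero (hG.scalarProduct x hx) ?_ (J x) (hφ.kahler.sq_neg x hx)
      (hφ.kahler.isometry x hx) fun u v => ?_
    · constructor <;> intros <;> simp only [map_add, map_smul, add_apply, smul_apply]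
    · rw [hφ.kahler.covDeriv_commute hx hγ (hK x hx), hφ.secondFormL_complex hx]
  have hB : traceOf G x (fun u v => secondFormL G H φ x u (covDeriv G X x v)) =
      (-((m - 2) / 2)) • secondFormL G H φ x (localGrad G γ x) (X x) := by
    have h1 := hG.trace_fderiv_smul' (f := γ) hx ((secondFormL G H φ x).flip (X x))
    simp only [ContinuousLinearMap.flip_apply] at h1
    simp only [hcovX, map_add, map_smul]
    rw [traceOf_add, traceOf_smul, traceOf_smul, hBA, h1, smul_zero, zero_add]
  have hB' : traceOf G x (fun u v => secondFormL G H φ x v (covDeriv G X x u)) =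
      (-((m - 2) / 2)) • secondFormL G H φ x (localGrad G γ x) (X x) := by
    rw [← hB]
    refine traceOf_swap (b := fun u v => secondFormL G H φ x u (covDeriv G X x v))
      (hG.scalarProduct x hx) ?_
    constructor <;> intros <;> simp only [map_add, map_smul, add_apply, smul_apply]
  -- Bilinearity of the two integrands allows the trace for `e^{2γ}G` to be rescaled to that for
  -- `G`, with a common factor that can be dropped.
  have hbil : IsBilinearMap ℝ (fun u v => covDerivSecondForm G H φ x u v (X x)
        + secondFormL G H φ x v (covDeriv G X x u) + secondFormL G H φ x u (covDeriv G X x v)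
        + fderiv ℝ φ x (covDerivEnd G (covDeriv G X) x u v)
        - L (fderiv ℝ γ x u • v + fderiv ℝ γ x v • u - G x u v • localGrad G γ x)) := by
    have b1 := isBilinearMap_covDerivSecondForm (G := G) (H := H) (φ := φ) (x := x) (X x)
    have b2 := isBilinearMap_covDerivEnd G (covDeriv G X) x
    constructor <;> intros <;> simp only [b1.add_left, b1.add_right, b1.smul_left, b1.smul_right,
      b2.add_left, b2.add_right, b2.smul_left, b2.smul_right, map_add, map_sub, map_smul, add_apply,
      smul_apply, smul_eq_mul] <;> module
  have hbil' : IsBilinearMap ℝ (fun u v => curvatureOf (christoffelL H) (φ x)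
      (fderiv ℝ φ x (X x)) (fderiv ℝ φ x u) (fderiv ℝ φ x v)) := by
    have b1 := isBilinearMap_curvatureOf (christoffelL H) (φ x) (fderiv ℝ φ x (X x))
    constructor <;> intros <;> simp only [b1.add_left, b1.add_right, b1.smul_left, b1.smul_right,
      map_add, map_smul]
  have hmain := hφ.kahler.trace_second_covDeriv_smul hx hγ hV hK hf hfγ hΔ
  rw [bitension, traceOf_congr hsecond, traceOf_congr hcurv,
    traceOf_conformal (hG.scalarProduct x hx) (Real.exp_pos _) rfl hbil,
    traceOf_conformal (hG.scalarProduct x hx) (Real.exp_pos _) rfl hbil', ← smul_add]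
  refine smul_eq_zero_of_right _ ?_
  -- The two curvature traces of the target cancel. The two `B` traces sum to `-(m-2) B(grad γ, X)`,
  -- which cancels against the `B` part of `L` applied to `(m-2) grad γ`. The rest is `dφ` of
  -- `hmain`, where `2b = m-2`.
  rw [traceOf_sub, traceOf_add, traceOf_add, traceOf_add, hφ.trace_covDerivSecondForm hx, hB, hB',
    traceOf_clm (fderiv ℝ φ x), traceOf_clm L, hG.trace_conformal_difference hx, map_smul L]
  have hmain' := congrArg (fderiv ℝ φ x) hmain
  simp only [map_add, map_smul, map_zero] at hmain'
  rw [hL]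
  simp only [add_apply, ContinuousLinearMap.flip_apply, ContinuousLinearMap.comp_apply]
  rw [← hmain', ← hm]
  simp only [hXdef, map_smul]
  module

end IsLocalHolomorphic

end Holomorphic

/-! ### Transfer of the structures to charts -/

section Charts

variable {E : Type*} [NormedAddCommGroup E] [NormedSpace ℝ E]
  {M : Type*} [TopologicalSpace M] [ChartedSpace E M] [IsManifold 𝓘(ℝ, E) ∞ M]
  {F : Type*} [NormedAddCommGroup F] [NormedSpace ℝ F]
  {N : Type*} [TopologicalSpace N] [ChartedSpace F N] [IsManifold 𝓘(ℝ, F) ∞ N]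
  {D : Type*} [NormedAddCommGroup D] [NormedSpace ℝ D]

/-- Smoothness of the differential on a smooth vector field along a map `b`. With the chart and its
inverse in place of `f`, it yields smoothness of frames and of coordinate components. -/
theorem contMDiffAt_mfderiv_apply {f : M → N} {b : D → M} {v : ∀ x, TangentSpace 𝓘(ℝ, E) (b x)}
    {x : D} (hf : ContMDiffAt 𝓘(ℝ, E) 𝓘(ℝ, F) ∞ f (b x))
    (hv : ContMDiffAt 𝓘(ℝ, D) 𝓘(ℝ, E).tangent ∞
      (fun y => (⟨b y, v y⟩ : TangentBundle 𝓘(ℝ, E) M)) x) :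
    ContMDiffAt 𝓘(ℝ, D) 𝓘(ℝ, F).tangent ∞ (fun y => (⟨f (b y),
      mfderiv 𝓘(ℝ, E) 𝓘(ℝ, F) f (b y) (v y)⟩ : TangentBundle 𝓘(ℝ, F) N)) x := by
  have : IsManifold 𝓘(ℝ, E) 1 M := IsManifold.of_le (n := ∞) (by simp)
  have : IsManifold 𝓘(ℝ, F) 1 N := IsManifold.of_le (n := ∞) (by simp)
  have hb : ContMDiffAt 𝓘(ℝ, D) 𝓘(ℝ, E) ∞ b x := (Bundle.contMDiffAt_totalSpace.1 hv).1
  have h1 := hf.mfderiv_const (m := ∞) (by simp)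
  exact ContMDiffAt.clm_apply_of_inCoordinates (h1.comp x hb) hv (hf.comp x hb)

theorem contMDiffAt_symm (p : M) {x : E} (hx : x ∈ (extChartAt 𝓘(ℝ, E) p).target) :
    ContMDiffAt 𝓘(ℝ, E) 𝓘(ℝ, E) ∞ (extChartAt 𝓘(ℝ, E) p).symm x :=
  (contMDiffOn_extChartAt_symm p).contMDiffAt ((isOpen_extChartAt_target p).mem_nhds hx)

theorem contMDiffAt_chart (p : M) {q : M} (hq : q ∈ (extChartAt 𝓘(ℝ, E) p).source) :
    ContMDiffAt 𝓘(ℝ, E) 𝓘(ℝ, E) ∞ (extChartAt 𝓘(ℝ, E) p) q :=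
  contMDiffAt_extChartAt' (by rwa [extChartAt_source] at hq)

theorem contMDiffAt_chartFrame (p : M) {x : E} (hx : x ∈ (extChartAt 𝓘(ℝ, E) p).target) (u : E) :
    ContMDiffAt 𝓘(ℝ, E) 𝓘(ℝ, E).tangent ∞ (fun y => (⟨(extChartAt 𝓘(ℝ, E) p).symm y,
      chartFrame p y u⟩ : TangentBundle 𝓘(ℝ, E) M)) x := by
  refine contMDiffAt_mfderiv_apply (b := fun y : E => y) (v := fun _ => u) (contMDiffAt_symm p hx) ?_
  exact contMDiffAt_vectorSpace_iff_contDiffAt.2 contDiffAt_const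

theorem chartCoframe_chartFrame (p : M) {x : E} (hx : x ∈ (extChartAt 𝓘(ℝ, E) p).target) (u : E) :
    chartCoframe p ((extChartAt 𝓘(ℝ, E) p).symm x) (chartFrame p x u) = u := by
  have : IsManifold 𝓘(ℝ, E) 1 M := IsManifold.of_le (n := ∞) (by simp)
  have h := mfderiv_extChartAt_comp_mfderivWithin_extChartAt_symm (I := 𝓘(ℝ, E)) hx
  rw [ModelWithCorners.range_eq_univ, mfderivWithin_univ] at h
  exact congrArg (fun L : E →L[ℝ] E => L u) h

theorem chartFrame_chartCoframe (p : M) {x : E} (hx : x ∈ (extChartAt 𝓘(ℝ, E) p).target)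
    (v : TangentSpace 𝓘(ℝ, E) ((extChartAt 𝓘(ℝ, E) p).symm x)) :
    chartFrame p x (chartCoframe p ((extChartAt 𝓘(ℝ, E) p).symm x) v) = v := by
  have : IsManifold 𝓘(ℝ, E) 1 M := IsManifold.of_le (n := ∞) (by simp)
  have h := mfderivWithin_extChartAt_symm_comp_mfderiv_extChartAt (I := 𝓘(ℝ, E)) hx
  rw [ModelWithCorners.range_eq_univ, mfderivWithin_univ] at h
  exact congrArg (fun L : E →L[ℝ] E => L v) h

variable [FiniteDimensional ℝ E] [FiniteDimensional ℝ F]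

theorem metricInChart_apply (g : Metric E M) (p : M) (x u v : E) :
    metricInChart g p x u v =
      g.inner ((extChartAt 𝓘(ℝ, E) p).symm x) (chartFrame p x u) (chartFrame p x v) := rfl

theorem contDiffAt_of_apply {U : Set D} (hU : IsOpen U) {A : D → E →L[ℝ] F}
    (h : ∀ x ∈ U, ∀ u, ContDiffAt ℝ ∞ (fun y => A y u) x) {x : D} (hx : x ∈ U) :
    ContDiffAt ℝ ∞ A x :=
  (contDiffOn_clm_apply.2 fun u y hy => (h y hy u).contDiffWithinAt).contDiffAt (hU.mem_nhds hx)

theorem contDiffAt_inner_chartFrame (g : Metric E M) (p : M) {x : E}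
    (hx : x ∈ (extChartAt 𝓘(ℝ, E) p).target) (u v : E) :
    ContDiffAt ℝ ∞ (fun y => g.inner ((extChartAt 𝓘(ℝ, E) p).symm y)
      (chartFrame p y u) (chartFrame p y v)) x := by
  have h : ContMDiffAt 𝓘(ℝ, E) (𝓘(ℝ, E).prod 𝓘(ℝ)) ∞
      (fun y => Bundle.TotalSpace.mk' ℝ (E := Bundle.Trivial M ℝ) ((extChartAt 𝓘(ℝ, E) p).symm y)
        (g.inner _ (chartFrame p y u) (chartFrame p y v))) x := by
    apply ContMDiffAt.clm_bundle_apply₂ (F₁ := E) (F₂ := E)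
    · exact (g.contMDiff.contMDiffAt).comp x (contMDiffAt_symm p hx)
    · exact contMDiffAt_chartFrame p hx u
    · exact contMDiffAt_chartFrame p hx v
  simp only [Bundle.contMDiffAt_totalSpace] at h
  exact h.2.contDiffAt

theorem chartFrame_ne_zero (p : M) {x : E} (hx : x ∈ (extChartAt 𝓘(ℝ, E) p).target) {u : E}
    (hu : u ≠ 0) : chartFrame p x u ≠ 0 := fun h0 => hu (by
  rw [← chartCoframe_chartFrame p hx u, h0, map_zero])

theorem isLocalMetric_metricInChart (g : Metric E M) (p : M) :
    IsLocalMetric (extChartAt 𝓘(ℝ, E) p).target (metricInChart g p) where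
  isOpen := isOpen_extChartAt_target p
  contDiffAt _ hx :=
    contDiffAt_of_apply (isOpen_extChartAt_target p) (fun _ hy u =>
      contDiffAt_of_apply (A := fun y => metricInChart g p y u) (isOpen_extChartAt_target p)
        (fun _ hz v => contDiffAt_inner_chartFrame g p hz u v) hy) hx
  scalarProduct x hx :=
    { symm := fun u v => g.symm _ (chartFrame p x u) (chartFrame p x v)
      pos := fun u hu => g.pos _ (chartFrame p x u) (chartFrame_ne_zero p hx hu) }

theorem complexInChart_apply (J : AlmostComplexStructure E M) (p : M) (x u : E) :
    complexInChart J p x u = chartCoframe p ((extChartAt 𝓘(ℝ, E) p).symm x)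
      (J.toFun ((extChartAt 𝓘(ℝ, E) p).symm x) (chartFrame p x u)) := rfl

theorem chartFrame_complexInChart (J : AlmostComplexStructure E M) (p : M) {x : E}
    (hx : x ∈ (extChartAt 𝓘(ℝ, E) p).target) (u : E) :
    chartFrame p x (complexInChart J p x u) =
      J.toFun ((extChartAt 𝓘(ℝ, E) p).symm x) (chartFrame p x u) :=
  chartFrame_chartCoframe p hx _

theorem isLocalHermitian_inChart {g : Metric E M} {J : AlmostComplexStructure E M}
    (h : IsAlmostHermitian g J) (p : M) :
    IsLocalHermitian (extChartAt 𝓘(ℝ, E) p).target (metricInChart g p) (complexInChart J p) where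
  toIsLocalMetric := isLocalMetric_metricInChart g p
  contDiffAt_complex x hx := by
    refine contDiffAt_of_apply (isOpen_extChartAt_target p) (fun y hy u => ?_) hx
    have h1 : ContMDiffAt 𝓘(ℝ, E) 𝓘(ℝ, E).tangent ∞ (fun y => (⟨(extChartAt 𝓘(ℝ, E) p).symm y,
        J.toFun _ (chartFrame p y u)⟩ : TangentBundle 𝓘(ℝ, E) M)) y := by
      apply ContMDiffAt.clm_bundle_apply (F₁ := E) (F₂ := E)
      · exact (J.contMDiff.contMDiffAt).comp y (contMDiffAt_symm p hy)
      · exact contMDiffAt_chartFrame p hy u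
    have h2 := contMDiffAt_mfderiv_apply
      (contMDiffAt_chart p ((extChartAt 𝓘(ℝ, E) p).map_target hy)) h1
    have h3 := (Bundle.contMDiffAt_totalSpace.1 h2).2.contDiffAt
    simp only [trivializationAt_model_space_apply] at h3
    exact h3
  sq_neg x hx u := by
    rw [complexInChart_apply, chartFrame_complexInChart J p hx, J.sq_eq_neg, map_neg,
      chartCoframe_chartFrame p hx]
  isometry x hx u v := by
    rw [metricInChart_apply, chartFrame_complexInChart J p hx, chartFrame_complexInChart J p hx, h]
    rfl

theorem isLocalKahler_inChart {g : Metric E M} {J : AlmostComplexStructure E M}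
    (h : IsKahler g J) (p : M) :
    IsLocalKahler (extChartAt 𝓘(ℝ, E) p).target (metricInChart g p) (complexInChart J p) where
  toIsLocalHermitian := isLocalHermitian_inChart h.1 p
  parallel x hx := h.2 p x hx

theorem contDiffAt_comp_symm {γ : M → ℝ} (hγ : ContMDiff 𝓘(ℝ, E) 𝓘(ℝ, ℝ) ∞ γ) (p : M) {x : E}
    (hx : x ∈ (extChartAt 𝓘(ℝ, E) p).target) :
    ContDiffAt ℝ ∞ (γ ∘ (extChartAt 𝓘(ℝ, E) p).symm) x :=
  (hγ.contMDiffAt.comp x (contMDiffAt_symm p hx)).contDiffAt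

theorem fderiv_comp_symm {γ : M → ℝ} (hγ : ContMDiff 𝓘(ℝ, E) 𝓘(ℝ, ℝ) ∞ γ) (p : M) {x : E}
    (hx : x ∈ (extChartAt 𝓘(ℝ, E) p).target) (u : E) :
    fderiv ℝ (γ ∘ (extChartAt 𝓘(ℝ, E) p).symm) x u =
      mvfderiv 𝓘(ℝ, E) γ ((extChartAt 𝓘(ℝ, E) p).symm x) (chartFrame p x u) := by
  rw [← mfderiv_eq_fderiv, mfderiv_comp x (hγ.contMDiffAt.mdifferentiableAt (by simp))
    ((contMDiffAt_symm p hx).mdifferentiableAt (by simp))]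
  rfl

theorem inner_grad (g : Metric E M) (f : M → ℝ) (q : M) (v : TangentSpace 𝓘(ℝ, E) q) :
    g.inner q (grad g f q) v = mvfderiv 𝓘(ℝ, E) f q v :=
  IsScalarProduct.inverse_apply (E := E) (B := g.inner q) ⟨g.symm q, g.pos q⟩ _ v

theorem localGrad_inChart (g : Metric E M) {γ : M → ℝ} (hγ : ContMDiff 𝓘(ℝ, E) 𝓘(ℝ, ℝ) ∞ γ) (p : M)
    {x : E} (hx : x ∈ (extChartAt 𝓘(ℝ, E) p).target) :
    localGrad (metricInChart g p) (γ ∘ (extChartAt 𝓘(ℝ, E) p).symm) x =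
      chartCoframe p ((extChartAt 𝓘(ℝ, E) p).symm x)
        (grad g γ ((extChartAt 𝓘(ℝ, E) p).symm x)) := by
  have hG := isLocalMetric_metricInChart g p
  refine (hG.scalarProduct x hx).ext_left fun w => ?_
  rw [hG.inner_localGrad hx, fderiv_comp_symm hγ p hx, metricInChart_apply,
    chartFrame_chartCoframe p hx, inner_grad]

theorem chartFrame_localGrad (g : Metric E M) {γ : M → ℝ} (hγ : ContMDiff 𝓘(ℝ, E) 𝓘(ℝ, ℝ) ∞ γ)
    (p : M) {x : E} (hx : x ∈ (extChartAt 𝓘(ℝ, E) p).target) :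
    chartFrame p x (localGrad (metricInChart g p) (γ ∘ (extChartAt 𝓘(ℝ, E) p).symm) x) =
        grad g γ ((extChartAt 𝓘(ℝ, E) p).symm x) := by
  rw [localGrad_inChart g hγ p hx, chartFrame_chartCoframe p hx]

/-- Matches the global Killing hypothesis with the field used in the local computation. -/
theorem fieldInChart_eq (g : Metric E M) (J : AlmostComplexStructure E M) {γ : M → ℝ}
    (hγ : ContMDiff 𝓘(ℝ, E) 𝓘(ℝ, ℝ) ∞ γ) (p : M) (a : ℝ) {x : E}
    (hx : x ∈ (extChartAt 𝓘(ℝ, E) p).target) :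
    fieldInChart (fun q => J.toFun q (Real.exp (a * γ q) • grad g γ q)) p x =
      complexInChart J p x (Real.exp (a * (γ ∘ (extChartAt 𝓘(ℝ, E) p).symm) x) •
        localGrad (metricInChart g p) (γ ∘ (extChartAt 𝓘(ℝ, E) p).symm) x) := by
  rw [complexInChart_apply, map_smul, chartFrame_localGrad g hγ p hx]
  rfl

theorem lieDerivMetric_congr {G : E → E →L[ℝ] E →L[ℝ] ℝ} {U : Set E} (hU : IsOpen U) {x : E}
    (hx : x ∈ U) {X Y : E → E} (h : ∀ y ∈ U, X y = Y y) (u v : E) :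
    lieDerivMetric G X x u v = lieDerivMetric G Y x u v := by
  rw [lieDerivMetric, lieDerivMetric, fderiv_eq_of_eqOn hU hx h, h x hx]

end Charts

/-! ### Maps read in charts -/

section MapsInCharts

variable {E : Type*} [NormedAddCommGroup E] [NormedSpace ℝ E] [FiniteDimensional ℝ E]
  {M : Type*} [TopologicalSpace M] [ChartedSpace E M] [IsManifold 𝓘(ℝ, E) ∞ M]
  {F : Type*} [NormedAddCommGroup F] [NormedSpace ℝ F] [FiniteDimensional ℝ F]
  {N : Type*} [TopologicalSpace N] [ChartedSpace F N] [IsManifold 𝓘(ℝ, F) ∞ N]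

theorem IsLocalKahler.mono {U V : Set E} {G : E → E →L[ℝ] E →L[ℝ] ℝ} {J : E → E →L[ℝ] E}
    (h : IsLocalKahler U G J) (hV : IsOpen V) (hVU : V ⊆ U) : IsLocalKahler V G J where
  isOpen := hV
  contDiffAt x hx := h.contDiffAt x (hVU hx)
  scalarProduct x hx := h.scalarProduct x (hVU hx)
  contDiffAt_complex x hx := h.contDiffAt_complex x (hVU hx)
  sq_neg x hx := h.sq_neg x (hVU hx)
  isometry x hx := h.isometry x (hVU hx)
  parallel x hx := h.parallel x (hVU hx)

theorem complexInChart_chartCoframe (J : AlmostComplexStructure F N) (p : N) {q : N}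
    (hq : q ∈ (extChartAt 𝓘(ℝ, F) p).source) (v : TangentSpace 𝓘(ℝ, F) q) :
    complexInChart J p (extChartAt 𝓘(ℝ, F) p q) (chartCoframe p q v) =
      chartCoframe p q (J.toFun q v) := by
  obtain ⟨y, hy, rfl⟩ : ∃ y ∈ (extChartAt 𝓘(ℝ, F) p).target, (extChartAt 𝓘(ℝ, F) p).symm y = q :=
    ⟨_, (extChartAt 𝓘(ℝ, F) p).map_source hq, (extChartAt 𝓘(ℝ, F) p).left_inv hq⟩
  rw [(extChartAt 𝓘(ℝ, F) p).right_inv hy, complexInChart_apply, chartFrame_chartCoframe p hy]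

/-- The part of the chart domain around `p` that `φ` maps into the chart domain around `φ p`. -/
def chartDomain (φ : M → N) (p : M) : Set E :=
  (extChartAt 𝓘(ℝ, E) p).target ∩
    (extChartAt 𝓘(ℝ, E) p).symm ⁻¹' (φ ⁻¹' (extChartAt 𝓘(ℝ, F) (φ p)).source)

theorem isOpen_chartDomain {φ : M → N} (hφ : Continuous φ) (p : M) :
    IsOpen (chartDomain (E := E) (F := F) φ p) :=
  (continuousOn_extChartAt_symm p).isOpen_inter_preimage (isOpen_extChartAt_target p)
    ((isOpen_extChartAt_source (φ p)).preimage hφ)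

theorem mem_chartDomain (φ : M → N) (p : M) :
    extChartAt 𝓘(ℝ, E) p p ∈ chartDomain (E := E) (F := F) φ p :=
  ⟨mem_extChartAt_target p, by simp⟩

variable {φ : M → N}

theorem isLocalMap_writtenInExtChartAt (hφ : ContMDiff 𝓘(ℝ, E) 𝓘(ℝ, F) ∞ φ) (p : M) :
    IsLocalMap (chartDomain (E := E) (F := F) φ p) (extChartAt 𝓘(ℝ, F) (φ p)).target
      (writtenInExtChartAt 𝓘(ℝ, E) 𝓘(ℝ, F) p φ) where
  contDiffAt x hx := ((contMDiffAt_chart (φ p) hx.2).comp x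
    (hφ.contMDiffAt.comp x (contMDiffAt_symm p hx.1))).contDiffAt
  mapsTo _ hx := (extChartAt 𝓘(ℝ, F) (φ p)).map_source hx.2

theorem fderiv_writtenInExtChartAt (hφ : ContMDiff 𝓘(ℝ, E) 𝓘(ℝ, F) ∞ φ) (p : M) {x : E}
    (hx : x ∈ chartDomain (E := E) (F := F) φ p)
    (v : E) : fderiv ℝ (writtenInExtChartAt 𝓘(ℝ, E) 𝓘(ℝ, F) p φ) x v =
      chartCoframe (φ p) (φ ((extChartAt 𝓘(ℝ, E) p).symm x))
        (mfderiv 𝓘(ℝ, E) 𝓘(ℝ, F) φ ((extChartAt 𝓘(ℝ, E) p).symm x) (chartFrame p x v)) := by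
  have h1 := (contMDiffAt_symm p hx.1).mdifferentiableAt (by simp)
  have h2 := (hφ.contMDiffAt (x := (extChartAt 𝓘(ℝ, E) p).symm x)).mdifferentiableAt (by simp)
  have h3 := (contMDiffAt_chart (φ p) hx.2).mdifferentiableAt (by simp)
  rw [← mfderiv_eq_fderiv, writtenInExtChartAt, mfderiv_comp x h3 (h2.comp x h1),
    mfderiv_comp x h2 h1]
  rfl

end MapsInCharts

theorem isLocalHolomorphic_inChart {E : Type*} [NormedAddCommGroup E] [NormedSpace ℝ E]
    [FiniteDimensional ℝ E] {M : Type*} [TopologicalSpace M] [ChartedSpace E M]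
    [IsManifold 𝓘(ℝ, E) ∞ M] {F : Type*} [NormedAddCommGroup F] [NormedSpace ℝ F]
    [FiniteDimensional ℝ F] {N : Type*} [TopologicalSpace N] [ChartedSpace F N]
    [IsManifold 𝓘(ℝ, F) ∞ N] {g : Metric E M} {J : AlmostComplexStructure E M}
    (hK : IsKahler g J) {h : Metric F N} {J' : AlmostComplexStructure F N}
    (hN : IsOneTwoSymplectic h J') {φ : M → N} (hφ : IsHolomorphic J J' φ) (p : M) :
    IsLocalHolomorphic (chartDomain (E := E) (F := F) φ p) (extChartAt 𝓘(ℝ, F) (φ p)).target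
      (metricInChart g p) (metricInChart h (φ p)) (complexInChart J p) (complexInChart J' (φ p))
      (writtenInExtChartAt 𝓘(ℝ, E) 𝓘(ℝ, F) p φ) where
  toIsLocalMap := isLocalMap_writtenInExtChartAt hφ.1 p
  kahler := (isLocalKahler_inChart hK p).mono (isOpen_chartDomain hφ.1.continuous p)
    Set.inter_subset_left
  hermitian := isLocalHermitian_inChart hN.1 (φ p)
  oneTwoSymplectic y hy := hN.2 (φ p) y hy
  fderiv_complex x hx v := by
    rw [fderiv_writtenInExtChartAt hφ.1 p hx, fderiv_writtenInExtChartAt hφ.1 p hx,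
      chartFrame_complexInChart J p hx.1, hφ.2]
    exact (complexInChart_chartCoframe J' (φ p) hx.2 _).symm

end BiharmonicGeometry

end

/-! ### The theorem on manifolds -/

theorem proposition3
    {E : Type*} [NormedAddCommGroup E] [NormedSpace ℝ E] [FiniteDimensional ℝ E]
    {M : Type*} [TopologicalSpace M] [ChartedSpace E M] [IsManifold 𝓘(ℝ, E) ∞ M]
    {F : Type*} [NormedAddCommGroup F] [NormedSpace ℝ F] [FiniteDimensional ℝ F]
    {N : Type*} [TopologicalSpace N] [ChartedSpace F N] [IsManifold 𝓘(ℝ, F) ∞ N]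
    (g : BiharmonicGeometry.Metric E M) (J : BiharmonicGeometry.AlmostComplexStructure E M)
    (hK : BiharmonicGeometry.IsKahler g J)
    (γ : M → ℝ) (hγ : ContMDiff 𝓘(ℝ, E) 𝓘(ℝ, ℝ) ∞ γ)
    (hKilling : BiharmonicGeometry.IsKilling g (fun p =>
      J.toFun p (Real.exp (((Module.finrank ℝ E : ℝ) - 6) / 2 * γ p) •
        BiharmonicGeometry.grad g γ p)))
    (hΔ : ∀ p : M, BiharmonicGeometry.laplacian g γ p
      + ((Module.finrank ℝ E : ℝ) - 2) / 2 *
        g.inner p (BiharmonicGeometry.grad g γ p) (BiharmonicGeometry.grad g γ p) = 0)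
    (h : BiharmonicGeometry.Metric F N) (J' : BiharmonicGeometry.AlmostComplexStructure F N)
    (hN : BiharmonicGeometry.IsOneTwoSymplectic h J')
    (φ : M → N) (hφ : BiharmonicGeometry.IsHolomorphic J J' φ) :
    BiharmonicGeometry.IsBiharmonic (BiharmonicGeometry.conformal g γ hγ) h φ := by
  refine ⟨hφ.1, fun p => ?_⟩
  have hloc := BiharmonicGeometry.isLocalHolomorphic_inChart hK hN hφ p
  have hp : extChartAt 𝓘(ℝ, E) p p ∈ (extChartAt 𝓘(ℝ, E) p).target := mem_extChartAt_target p
  -- In a chart, the metric `e^{2γ}g` unfolds definitionally to `localConformal` of the coordinate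
  -- metric with `γ` read in the chart, so the local result applies at the centre of the chart.
  refine hloc.bitension_localConformal (γ := γ ∘ (extChartAt 𝓘(ℝ, E) p).symm)
    (fun y hy => BiharmonicGeometry.contDiffAt_comp_symm hγ p hy.1) (fun y hy u v => ?_)
    (BiharmonicGeometry.mem_chartDomain φ p) ?_
  · rw [← hKilling.2 p y hy.1 u v]
    exact BiharmonicGeometry.lieDerivMetric_congr (isOpen_extChartAt_target p) hy.1
      (fun z hz => (BiharmonicGeometry.fieldInChart_eq g J hγ p _ hz).symm) u v
  · rw [← hΔ p, BiharmonicGeometry.metricInChart_apply,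
      BiharmonicGeometry.chartFrame_localGrad g hγ p hp]
    -- The coordinate norm of the gradient lives at the chart preimage of the image of `p`. The base
    -- point is replaced by `p` in the whole expression, since the tangent spaces depend on it.
    have hinv : (extChartAt 𝓘(ℝ, E) p).symm (extChartAt 𝓘(ℝ, E) p p) = p := by simp
    have hnorm := congrArg (fun q => g.inner q (BiharmonicGeometry.grad g γ q)
      (BiharmonicGeometry.grad g γ q)) hinv
    rw [hnorm]
    rfl
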